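/- **Model.** Let $(X_k)_{k\ge 0}$ be a hidden Markov chain on $\mathbb{R}^d$ (for instance the solution of an SDE at discrete times) with, with respect to a $\sigma$-finite reference measure $\mu$, initial density $\chi$ and transition densities $q_k(x,\cdot)$ (law of $X_{k+1}$ given $X_k=x$). The observations $Y_0,Y_1,\dots$ are fixed, and $g_k(x)$ is the density at $Y_k$ of the law of $Y_k$ given $X_k=x$. Let $\phi_{0:k|k}$ be the conditional law of $X_{0:k}$ given $Y_{0:k}$, i.e. the probability measure proportional to $\chi(x_0)\prod_{j<k}q_j(x_j,x_{j+1})\prod_{j\le k}g_j(x_j)\,\mu(\mathrm{d}x_0)\cdots\mu(\mathrm{d}x_k)$, and let $\phi_k$ be its last marginal. Let $n\ge 0$; for measurable $h_0,\dots,h_{n-1}:\mathbb{R}^d\times\mathbb{R}^d\to\mathbb{R}$ and $k\le n$ put $H_k=\sum_{j=0}^{k-1}h_j(x_j,x_{j+1})$ and $T_k[H_k](x)=\mathbb{E}[H_k(X_{0:k})\mid X_k=x,Y_{0:k}]$. **Algorithm (GRand PaRIS).** Let $\eta_0$ be a proposal density with $\eta_0>0$ wherever $\chi>0$; for $k\ge1$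 let $\vartheta_k>0$ be adjustment multipliers and $p_k(x,\cdot)>0$ proposal densities (with respect to $\mu$); for $k\ge 0$ let $\widehat q_k(x,y;\zeta)$ be an almost surely positive unbiased estimator of $q_k(x,y)$, where $\zeta$ has a given law depending on $(k,x,y)$. Set $$\widehat\omega_0(x)=\frac{\chi(x)g_0(x)}{\eta_0(x)},\qquad \widehat\omega_{k+1}(x,y;z)=\frac{\widehat q_k(x,y;z)\,g_{k+1}(y)}{\vartheta_{k+1}(x)\,p_{k+1}(x,y)}\quad(k\ge0).$$ Fix integers $N\ge1$ and $\widetilde N\ge1$. At time $0$ draw $\xi_0^1,\dots,\xi_0^N$ independently from $\eta_0$ and put $\widehat\omega_0^i=\widehat\omega_0(\xi_0^i)$, $\tau_0^i=0$. Given $(\xi_k^i,\widehat\omega_k^i,\tau_k^i)_{i\le N}$, independently for each $i$ draw $I^i$ with probabilities proportional to $\widehat\omega_k^j\vartheta_{k+1}(\xi_k^j)$, then $\xi_{k+1}^i\sim p_{k+1}(\xi_k^{I^i},\cdot)$, then $\zeta^i$ with the law attached to $(k,\xi_k^{I^i},\xi_{k+1}^i)$, and put $\widehat\omega_{k+1}^i=\widehat\omega_{k+1}(\xi_k^{I^i},\xi_{k+1}^i;\zeta^i)$.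 Then draw, independently given the above, $J^{i,1},\dots,J^{i,\widetilde N}$ with probabilities $$\Lambda_k^N(i,j)\propto\widehat\omega_k^j\,q_k(\xi_k^j,\xi_{k+1}^i),\qquad 1\le j\le N,$$ and put $$\tau_{k+1}^i=\frac1{\widetilde N}\sum_{\ell=1}^{\widetilde N}\left(\tau_k^{J^{i,\ell}}+h_k(\xi_k^{J^{i,\ell}},\xi_{k+1}^i)\right).$$ The $J^{i,\ell}$ may be drawn directly from $\Lambda_k^N(i,\cdot)$, or by accept-reject: repeat independent draws of $J$ with probabilities proportional to $\widehat\omega_k^j$, of $\zeta$ with the law attached to $(k,\xi_k^J,\xi_{k+1}^i)$ and of an independent $U$ uniform on $[0,1]$, until $U\le\widehat q_k(\xi_k^J,\xi_{k+1}^i;\zeta)/\widehat\sigma$, where $\widehat\sigma$ is any measurable function of the particles at times $k$ and $k+1$ with $\sup_{i,j,\zeta}\widehat q_k(\xi_k^j,\xi_{k+1}^i;\zeta)\le\widehat\sigma$. If all the weights that define a draw of an index vanish, the index is drawn uniformly. The estimator is $\phi_k^N[\tau_k]=\sum_i\widehat\omega_k^i\tau_k^i/\sum_i\widehat\omega_k^i$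 (read as $0$ if the denominator vanishes). **Assumptions.** (H1) $g_k(x)>0$ for all $k\ge 0$ and all $x$, and $\sup_{k\ge0}|g_k|_\infty<\infty$. (H2) $\sup_{k\ge1}|\vartheta_k|_\infty<\infty$, $\sup_{k\ge1}|p_k|_\infty<\infty$ and $\sup_{k\ge0}|\widehat\omega_k|_\infty<\infty$, where $|\cdot|_\infty$ is the sup norm. Moreover $\mathrm{osc}(h_j)=\sup_{u,u'}|h_j(u)-h_j(u')|<\infty$ for $0\le j\le n-1$. **Proposition.** For all $0\le k\le n$ and all $\widetilde N\ge1$ there exist $b_k,c_k>0$ such that for all $N\ge1$ and all $\varepsilon>0$, and for both ways of drawing the indices $J^{i,\ell}$ (and any choice of the bounds $\widehat\sigma$), $$\mathbb{P}\left(\left|\phi_k^N[\tau_k]-\phi_k\big[T_k[H_k]\big]\right|\ge\varepsilon\right)\le b_k\exp\left(-c_kN\varepsilon^2\right).$$ -/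

import Mathlib

open MeasureTheory ProbabilityTheory
open scoped ENNReal BigOperators ProbabilityTheory

noncomputable section

namespace GRandPaRIS

/-! ### Sup norm and oscillation -/

/-- The sup norm `|f|_∞ = sup_x |f x|`, as an extended nonnegative real. -/
def supNorm {α : Type*} (f : α → ℝ) : ℝ≥0∞ := ⨆ x, ‖f x‖ₑ

/-- The oscillation `osc f = sup_{x,x'} |f x - f x'|`, as an extended nonnegative real. -/
def osc {α : Type*} (f : α → ℝ) : ℝ≥0∞ := ⨆ x, ⨆ x', edist (f x) (f x')

/-! ### Generic kernels -/

/-- The kernel `a ↦ ⨂ᵢ κᵢ(a, ·)`: given `a`, the coordinates are drawn independently. -/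
def piKernel {α β ι : Type*} [MeasurableSpace α] [MeasurableSpace β] [Fintype ι]
    (κ : ι → Kernel α β) [∀ i, IsFiniteKernel (κ i)] : Kernel α (ι → β) where
  toFun a := Measure.pi fun i => κ i a
  measurable' := by
    refine Measurable.measure_of_isPiSystem generateFrom_pi.symm isPiSystem_pi ?_ ?_
    · rintro s ⟨t, ht, rfl⟩
      simp only [Measure.pi_pi]
      exact Finset.measurable_prod _ fun i _ =>
        Kernel.measurable_coe (κ i) (ht i (Set.mem_univ i))
    · simp only [Measure.pi_univ]
      exact Finset.measurable_prod _ fun i _ => Kernel.measurable_coe (κ i) MeasurableSet.univ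

instance {α β ι : Type*} [MeasurableSpace α] [MeasurableSpace β] [Fintype ι]
    (κ : ι → Kernel α β) [∀ i, IsMarkovKernel (κ i)] : IsMarkovKernel (piKernel κ) :=
  ⟨fun a => by
    change IsProbabilityMeasure (Measure.pi fun i => κ i a)
    infer_instance⟩

/-- Probabilities proportional to the weights `w` (uniform if all the weights vanish). -/
def proportional {N : ℕ} (w : Fin N → ℝ) (j : Fin N) : ℝ≥0∞ :=
  if ∑ i, ENNReal.ofReal (w i) = 0 then (N : ℝ≥0∞)⁻¹
  else ENNReal.ofReal (w j) / ∑ i, ENNReal.ofReal (w i)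

lemma measurable_proportional {N : ℕ} (j : Fin N) :
    Measurable fun w : Fin N → ℝ => proportional w j := by
  unfold proportional
  refine Measurable.ite ?_ measurable_const ?_
  · exact (measurableSet_singleton (0 : ℝ≥0∞)).preimage (by fun_prop)
  · fun_prop

lemma sum_proportional {N : ℕ} [NeZero N] (w : Fin N → ℝ) : ∑ j, proportional w j = 1 := by
  unfold proportional
  by_cases h : ∑ i, ENNReal.ofReal (w i) = 0
  · simp only [h, if_true, Finset.sum_const, Finset.card_univ, Fintype.card_fin, nsmul_eq_mul]
    exact ENNReal.mul_inv_cancel (by simpa using NeZero.ne N) (by simp)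
  · simp only [h, if_false, div_eq_mul_inv]
    rw [← Finset.sum_mul]
    exact ENNReal.mul_inv_cancel h (by simp)

/-- The kernel drawing an index with probabilities proportional to given weights. -/
def categorical (N : ℕ) : Kernel (Fin N → ℝ) (Fin N) where
  toFun w := ∑ j, proportional w j • Measure.dirac j
  measurable' := by
    refine Measure.measurable_of_measurable_coe _ fun s _ => ?_
    simp only [Measure.coe_finsetSum, Finset.sum_apply, Measure.smul_apply, smul_eq_mul]
    exact Finset.measurable_sum _ fun j _ => (measurable_proportional j).mul_const _

instance (N : ℕ) [NeZero N] : IsMarkovKernel (categorical N) :=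
  ⟨fun w => ⟨by
    change (∑ j, proportional w j • Measure.dirac j : Measure (Fin N)) Set.univ = 1
    simpa using sum_proportional w⟩⟩

/-- The law of the output of an accept-reject loop: independent trials are drawn from `κ a` until
one of them falls in the acceptance region `{b | (a, b) ∈ A}`, and that trial is returned. The
`m`-th summand corresponds to `m` rejections followed by an acceptance. -/
def acceptReject {α β : Type*} [MeasurableSpace α] [MeasurableSpace β]
    (κ : Kernel α β) [IsMarkovKernel κ] (A : Set (α × β)) (hA : MeasurableSet A) :
    Kernel α β where
  toFun a := Measure.sum fun m : ℕ =>
    (κ a {b | (a, b) ∉ A}) ^ m • (κ a).restrict {b | (a, b) ∈ A}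
  measurable' := by
    refine Measure.measurable_of_measurable_coe _ fun s hs => ?_
    simp only [Measure.sum_apply _ hs, Measure.smul_apply, Measure.restrict_apply hs, smul_eq_mul]
    refine Measurable.tsum fun m => ?_
    refine Measurable.mul (Measurable.pow_const ?_ m) ?_
    · exact Kernel.measurable_kernel_prodMk_left (κ := κ) hA.compl
    · exact Kernel.measurable_kernel_prodMk_left (κ := κ) ((hs.preimage measurable_snd).inter hA)

instance {α β : Type*} [MeasurableSpace α] [MeasurableSpace β]
    (κ : Kernel α β) [IsMarkovKernel κ] (A : Set (α × β)) (hA : MeasurableSet A) :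
    IsFiniteKernel (acceptReject κ A hA) :=
  ⟨⟨1, ENNReal.one_lt_top, fun a => by
    have hm : MeasurableSet {b | (a, b) ∈ A} := hA.preimage measurable_prodMk_left
    change (Measure.sum fun m : ℕ =>
      (κ a {b | (a, b) ∉ A}) ^ m • (κ a).restrict {b | (a, b) ∈ A}) Set.univ ≤ 1
    have hc : κ a {b | (a, b) ∉ A} = 1 - κ a {b | (a, b) ∈ A} :=
      prob_compl_eq_one_sub hm
    have hle : κ a {b | (a, b) ∈ A} ≤ 1 := prob_le_one
    simp only [Measure.sum_apply _ MeasurableSet.univ, Measure.smul_apply,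
      Measure.restrict_apply MeasurableSet.univ, Set.univ_inter, smul_eq_mul]
    rw [ENNReal.tsum_mul_right, ENNReal.tsum_geometric, hc,
      ENNReal.sub_sub_cancel ENNReal.one_ne_top hle]
    exact ENNReal.inv_mul_le_one _⟩⟩

/-! ### The hidden Markov model, filtering and smoothing -/

/-- A hidden Markov chain in `ℝ^d` for a fixed record of observations: `χ` is the density of `X 0`
and `q k x` the density of `X (k+1)` given `X k = x` with respect to the reference measure `μ`;
`g k x` is the density, at the recorded observation `Y k`, of the law of `Y k` given `X k = x`. -/
structure Model (d : ℕ) where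
  μ : Measure (EuclideanSpace ℝ (Fin d))
  sigmaFinite : SigmaFinite μ
  χ : EuclideanSpace ℝ (Fin d) → ℝ
  χ_meas : Measurable χ
  χ_nonneg : ∀ x, 0 ≤ χ x
  χ_density : ∫⁻ x, ENNReal.ofReal (χ x) ∂μ = 1
  q : ℕ → EuclideanSpace ℝ (Fin d) → EuclideanSpace ℝ (Fin d) → ℝ
  q_meas : ∀ k, Measurable (Function.uncurry (q k))
  q_nonneg : ∀ k x y, 0 ≤ q k x y
  q_density : ∀ k x, ∫⁻ y, ENNReal.ofReal (q k x y) ∂μ = 1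
  g : ℕ → EuclideanSpace ℝ (Fin d) → ℝ
  g_meas : ∀ k, Measurable (g k)
  g_nonneg : ∀ k x, 0 ≤ g k x

attribute [instance] Model.sigmaFinite

namespace Model

variable {d : ℕ} (M : Model d)

/-- The joint density of `(X 0, …, X k)` and of the recorded observations `Y 0, …, Y k`. -/
def jointDensity (k : ℕ) (x : Fin (k + 1) → EuclideanSpace ℝ (Fin d)) : ℝ :=
  M.χ (x 0) * (∏ j : Fin k, M.q j (x j.castSucc) (x j.succ)) * ∏ j : Fin (k + 1), M.g j (x j)

/-- The joint smoothing distribution `φ_{0:k|k}`: the conditional law of `(X 0, …, X k)` given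
the observations `Y 0, …, Y k` (normalized joint density). -/
def smoothing (k : ℕ) : Measure (Fin (k + 1) → EuclideanSpace ℝ (Fin d)) :=
  ((Measure.pi fun _ => M.μ).withDensity fun x => ENNReal.ofReal (M.jointDensity k x))[|Set.univ]

instance (k : ℕ) : IsZeroOrProbabilityMeasure (M.smoothing k) := by
  unfold smoothing; infer_instance

/-- The filtering distribution `φ_k`: the conditional law of `X k` given `Y 0, …, Y k`. -/
def filter (k : ℕ) : Measure (EuclideanSpace ℝ (Fin d)) :=
  (M.smoothing k).map fun x => x (Fin.last k)

/-- `T_k[H](x) = E[H(X 0, …, X k) | X k = x, Y 0, …, Y k]`. -/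
def T (k : ℕ) (H : (Fin (k + 1) → EuclideanSpace ℝ (Fin d)) → ℝ)
    (x : EuclideanSpace ℝ (Fin d)) : ℝ :=
  ∫ path, H path ∂(condDistrib id (fun p => p (Fin.last k)) (M.smoothing k) x)

end Model

/-- The additive functional `H_k(x_0, …, x_k) = ∑_{j<k} h_j(x_j, x_{j+1})`. -/
def additive {d : ℕ} (h : ℕ → EuclideanSpace ℝ (Fin d) → EuclideanSpace ℝ (Fin d) → ℝ) (k : ℕ)
    (x : Fin (k + 1) → EuclideanSpace ℝ (Fin d)) : ℝ :=
  ∑ j : Fin k, h j (x j.castSucc) (x j.succ)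

/-! ### The algorithm -/

/-- The ingredients of the particle algorithm: the initial proposal density `η₀`, the adjustment
multipliers `ϑ k` and the proposal densities `p k` used to produce the particles at time `k ≥ 1`,
and the positive unbiased estimator `qhat k x y ζ` of `q k x y`, where `ζ` has law
`ζlaw k (x, y)`. -/
structure Algo {d : ℕ} (M : Model d) (Z : Type*) [MeasurableSpace Z] where
  η₀ : EuclideanSpace ℝ (Fin d) → ℝ
  η₀_meas : Measurable η₀
  η₀_nonneg : ∀ x, 0 ≤ η₀ x
  η₀_density : ∫⁻ x, ENNReal.ofReal (η₀ x) ∂M.μ = 1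
  /-- the initial importance weight is well defined -/
  η₀_ne_zero : ∀ x, M.χ x ≠ 0 → η₀ x ≠ 0
  ϑ : ℕ → EuclideanSpace ℝ (Fin d) → ℝ
  ϑ_meas : ∀ k, Measurable (ϑ k)
  ϑ_pos : ∀ k x, 0 < ϑ k x
  p : ℕ → EuclideanSpace ℝ (Fin d) → EuclideanSpace ℝ (Fin d) → ℝ
  p_meas : ∀ k, Measurable (Function.uncurry (p k))
  p_pos : ∀ k x y, 0 < p k x y
  p_density : ∀ k x, ∫⁻ y, ENNReal.ofReal (p k x y) ∂M.μ = 1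
  ζlaw : ℕ → Kernel (EuclideanSpace ℝ (Fin d) × EuclideanSpace ℝ (Fin d)) Z
  ζlaw_markov : ∀ k, IsMarkovKernel (ζlaw k)
  qhat : ℕ → EuclideanSpace ℝ (Fin d) → EuclideanSpace ℝ (Fin d) → Z → ℝ
  qhat_meas : ∀ k, Measurable fun a : (EuclideanSpace ℝ (Fin d) × EuclideanSpace ℝ (Fin d)) × Z =>
    qhat k a.1.1 a.1.2 a.2
  qhat_pos : ∀ k x y, ∀ᵐ z ∂ζlaw k (x, y), 0 < qhat k x y z
  qhat_integrable : ∀ k x y, Integrable (qhat k x y) (ζlaw k (x, y))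
  qhat_unbiased : ∀ k x y, ∫ z, qhat k x y z ∂ζlaw k (x, y) = M.q k x y

attribute [instance] Algo.ζlaw_markov

/-- The particle system at a given time: `N` triples (position `ξ`, weight `ω̂`, statistic `τ`). -/
abbrev Swarm (d N : ℕ) : Type := Fin N → EuclideanSpace ℝ (Fin d) × ℝ × ℝ

/-- The `N` pairs (position `ξ`, weight `ω̂`). -/
abbrev Cloud (d N : ℕ) : Type := Fin N → EuclideanSpace ℝ (Fin d) × ℝ

namespace Algo

variable {d : ℕ} {M : Model d} {Z : Type*} [MeasurableSpace Z] (𝒜 : Algo M Z)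

/-- The initial importance weight `ω̂_0(x) = χ(x) g_0(x) / η₀(x)`. -/
def weightInit (x : EuclideanSpace ℝ (Fin d)) : ℝ := M.χ x * M.g 0 x / 𝒜.η₀ x

/-- The random importance weight of a particle at time `k + 1` at position `y` whose ancestor at
time `k` is at position `x`. -/
def weight (k : ℕ) (x y : EuclideanSpace ℝ (Fin d)) (z : Z) : ℝ :=
  𝒜.qhat k x y z * M.g (k + 1) y / (𝒜.ϑ (k + 1) x * 𝒜.p (k + 1) x y)

lemma measurable_weight (k : ℕ) :
    Measurable fun a : (EuclideanSpace ℝ (Fin d) × EuclideanSpace ℝ (Fin d)) × Z =>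
      𝒜.weight k a.1.1 a.1.2 a.2 := by
  unfold weight
  have h1 := 𝒜.qhat_meas k
  have h2 := M.g_meas (k + 1)
  have h3 := 𝒜.ϑ_meas (k + 1)
  have h4 : Measurable fun a : (EuclideanSpace ℝ (Fin d) × EuclideanSpace ℝ (Fin d)) × Z =>
      𝒜.p (k + 1) a.1.1 a.1.2 := (𝒜.p_meas (k + 1)).comp measurable_fst
  fun_prop

/-- The proposal kernel with density `p k` with respect to the reference measure. -/
def proposal (k : ℕ) : Kernel (EuclideanSpace ℝ (Fin d)) (EuclideanSpace ℝ (Fin d)) :=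
  Kernel.withDensity (Kernel.const _ M.μ) fun x y => ENNReal.ofReal (𝒜.p k x y)

instance (k : ℕ) : IsMarkovKernel (𝒜.proposal k) :=
  ⟨fun x => ⟨by
    have hm : Measurable (Function.uncurry fun x y => ENNReal.ofReal (𝒜.p k x y)) :=
      (𝒜.p_meas k).ennreal_ofReal
    rw [proposal, Kernel.withDensity_apply _ hm, withDensity_apply _ MeasurableSet.univ,
      Measure.restrict_univ, Kernel.const_apply]
    exact 𝒜.p_density k x⟩⟩

/-- Selection of an ancestor index at time `k`, with probabilities proportional to
`ω̂_k^j ϑ_{k+1}(ξ_k^j)`. -/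
def selection (N k : ℕ) : Kernel (Swarm d N) (Fin N) :=
  (categorical N).comap (fun s j => (s j).2.1 * 𝒜.ϑ (k + 1) (s j).1) (by
    have := 𝒜.ϑ_meas (k + 1)
    fun_prop)

instance (N k : ℕ) [NeZero N] : IsMarkovKernel (𝒜.selection N k) := by
  unfold selection; infer_instance

/-- The law of the position of the selected ancestor. -/
def ancestor (N k : ℕ) : Kernel (Swarm d N) (EuclideanSpace ℝ (Fin d)) :=
  (Kernel.id ×ₖ 𝒜.selection N k).map fun a : Swarm d N × Fin N => (a.1 a.2).1

lemma measurable_ancestor (N : ℕ) :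
    Measurable fun a : Swarm d N × Fin N => (a.1 a.2).1 :=
  measurable_from_prod_countable_left fun j => (measurable_pi_apply j).fst

instance (N k : ℕ) [NeZero N] : IsMarkovKernel (𝒜.ancestor N k) :=
  Kernel.IsMarkovKernel.map _ (measurable_ancestor N)

/-- The law, given the particle system at time `k`, of (position, weight) of one new particle:
draw the ancestor, then the position, then `ζ`, and compute the weight. -/
def offspring (N k : ℕ) [NeZero N] : Kernel (Swarm d N) (EuclideanSpace ℝ (Fin d) × ℝ) :=
  ((𝒜.ancestor N k ⊗ₖ (𝒜.proposal (k + 1)).comap Prod.snd measurable_snd) ⊗ₖ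
      (𝒜.ζlaw k).comap Prod.snd measurable_snd).map
    fun a => (a.1.2, 𝒜.weight k a.1.1 a.1.2 a.2)

instance (N k : ℕ) [NeZero N] : IsMarkovKernel (𝒜.offspring N k) :=
  Kernel.IsMarkovKernel.map _ (measurable_fst.snd.prodMk (𝒜.measurable_weight k))

/-- One particle filter step: the `N` new particles are drawn independently given the particle
system at time `k`. -/
def mutation (N k : ℕ) [NeZero N] : Kernel (Swarm d N) (Cloud d N) :=
  piKernel fun _ : Fin N => 𝒜.offspring N k

instance (N k : ℕ) [NeZero N] : IsMarkovKernel (𝒜.mutation N k) := by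
  unfold mutation; infer_instance

/-- Backward sampling for the `i`-th new particle: an index `j` is drawn with probabilities
`Λ_k^N(i, j)` proportional to `ω̂_k^j q_k(ξ_k^j, ξ_{k+1}^i)`. -/
def backwardIndex (M : Model d) (N k : ℕ) (i : Fin N) : Kernel (Swarm d N × Cloud d N) (Fin N) :=
  (categorical N).comap (fun a j => (a.1 j).2.1 * M.q k (a.1 j).1 (a.2 i).1) (by
    refine measurable_pi_lambda _ fun j => Measurable.mul (by fun_prop) ?_
    exact (M.q_meas k).comp (by fun_prop :
      Measurable fun a : Swarm d N × Cloud d N => ((a.1 j).1, (a.2 i).1)))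

instance (M : Model d) (N k : ℕ) [NeZero N] (i : Fin N) :
    IsMarkovKernel (backwardIndex M N k i) := by
  unfold backwardIndex; infer_instance

/-- One trial of the accept-reject version of backward sampling: `J` with probabilities
proportional to `ω̂_k^j`, then `ζ`, and an independent uniform `U` on `[0, 1]`. -/
def trial (N k : ℕ) (i : Fin N) : Kernel (Swarm d N × Cloud d N) (Fin N × Z × ℝ) :=
  (categorical N).comap (fun (a : Swarm d N × Cloud d N) j => (a.1 j).2.1) (by fun_prop) ⊗ₖ
    ((𝒜.ζlaw k).comap
        (fun b : (Swarm d N × Cloud d N) × Fin N => ((b.1.1 b.2).1, (b.1.2 i).1)) (by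
          refine Measurable.prodMk ?_ (by fun_prop)
          exact (measurable_ancestor N).comp (measurable_fst.fst.prodMk measurable_snd)) ×ₖ
      Kernel.const _ (volume.restrict (Set.Icc (0 : ℝ) 1)))

instance (N k : ℕ) [NeZero N] (i : Fin N) : IsMarkovKernel (𝒜.trial N k i) := by
  have : IsProbabilityMeasure (volume.restrict (Set.Icc (0 : ℝ) 1)) := ⟨by simp⟩
  unfold trial; infer_instance

/-- The acceptance region `U ≤ qhat_k(ξ_k^J, ξ_{k+1}^i; ζ) / σ`. -/
def acceptSet (N k : ℕ) (σ : Swarm d N × Cloud d N → ℝ) (i : Fin N) :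
    Set ((Swarm d N × Cloud d N) × Fin N × Z × ℝ) :=
  {b | b.2.2.2 ≤ 𝒜.qhat k (b.1.1 b.2.1).1 (b.1.2 i).1 b.2.2.1 / σ b.1}

lemma measurableSet_acceptSet (N k : ℕ) {σ : Swarm d N × Cloud d N → ℝ} (hσ : Measurable σ)
    (i : Fin N) : MeasurableSet (𝒜.acceptSet N k σ i) := by
  refine measurableSet_le (by fun_prop) (Measurable.div ?_ (by fun_prop))
  have h1 : Measurable fun b : (Swarm d N × Cloud d N) × Fin N × Z × ℝ => (b.1.1 b.2.1).1 :=
    (measurable_ancestor N).comp (measurable_fst.fst.prodMk measurable_snd.fst)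
  exact (𝒜.qhat_meas k).comp ((h1.prodMk (by fun_prop)).prodMk (by fun_prop))

/-- Backward sampling by accept-reject with the bound `σ`, a function of the particles at times
`k` and `k + 1`. -/
def acceptRejectIndex (N k : ℕ) [NeZero N] (σ : Swarm d N × Cloud d N → ℝ) (hσ : Measurable σ)
    (i : Fin N) : Kernel (Swarm d N × Cloud d N) (Fin N) :=
  (acceptReject (𝒜.trial N k i) (𝒜.acceptSet N k σ i) (𝒜.measurableSet_acceptSet N k hσ i)).map
    Prod.fst

instance (N k : ℕ) [NeZero N] (σ : Swarm d N × Cloud d N → ℝ) (hσ : Measurable σ) (i : Fin N) :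
    IsFiniteKernel (𝒜.acceptRejectIndex N k σ hσ i) := by
  unfold acceptRejectIndex; infer_instance

/-- Given the particles at times `k` and `k + 1`, the law of the new statistic
`τ_{k+1}^i = Ñ⁻¹ ∑_ℓ (τ_k^{J_ℓ} + h_k(ξ_k^{J_ℓ}, ξ_{k+1}^i))`, where `J_1, …, J_Ñ` are independent
with law `B`. -/
def statistic (h : ℕ → EuclideanSpace ℝ (Fin d) → EuclideanSpace ℝ (Fin d) → ℝ) (N Nt k : ℕ)
    (B : Kernel (Swarm d N × Cloud d N) (Fin N)) [IsFiniteKernel B] (i : Fin N) :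
    Kernel (Swarm d N × Cloud d N) ℝ :=
  (Kernel.id ×ₖ piKernel fun _ : Fin Nt => B).map
    fun b : (Swarm d N × Cloud d N) × (Fin Nt → Fin N) =>
      (Nt : ℝ)⁻¹ * ∑ l, ((b.1.1 (b.2 l)).2.2 + h k (b.1.1 (b.2 l)).1 (b.1.2 i).1)

lemma measurable_statistic {h : ℕ → EuclideanSpace ℝ (Fin d) → EuclideanSpace ℝ (Fin d) → ℝ}
    {k : ℕ} (hh : Measurable (Function.uncurry (h k))) (N Nt : ℕ) (i : Fin N) :
    Measurable fun b : (Swarm d N × Cloud d N) × (Fin Nt → Fin N) =>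
      (Nt : ℝ)⁻¹ * ∑ l, ((b.1.1 (b.2 l)).2.2 + h k (b.1.1 (b.2 l)).1 (b.1.2 i).1) := by
  refine measurable_from_prod_countable_left fun J => ?_
  change Measurable fun a : Swarm d N × Cloud d N =>
    (Nt : ℝ)⁻¹ * ∑ l, ((a.1 (J l)).2.2 + h k (a.1 (J l)).1 (a.2 i).1)
  refine Measurable.const_mul (Finset.measurable_sum _ fun l _ => Measurable.add ?_ ?_) _
  · fun_prop
  · exact hh.comp (by fun_prop :
      Measurable fun a : Swarm d N × Cloud d N => ((a.1 (J l)).1, (a.2 i).1))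

instance (h : ℕ → EuclideanSpace ℝ (Fin d) → EuclideanSpace ℝ (Fin d) → ℝ) (N Nt k : ℕ)
    (B : Kernel (Swarm d N × Cloud d N) (Fin N)) [IsFiniteKernel B] (i : Fin N) :
    IsFiniteKernel (statistic h N Nt k B i) := by
  have : IsFiniteKernel (piKernel fun _ : Fin Nt => B) :=
    ⟨⟨B.bound ^ Nt, ENNReal.pow_lt_top (Kernel.bound_lt_top B), fun a => by
      change Measure.pi (fun _ : Fin Nt => B a) Set.univ ≤ _
      rw [Measure.pi_univ, Finset.prod_const, Finset.card_univ, Fintype.card_fin]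
      gcongr
      exact Kernel.measure_le_bound B a _⟩⟩
  unfold statistic; infer_instance

/-- One step of the algorithm from time `k` to time `k + 1`, for a given family `B` of backward
samplers: new particles and weights first, then the statistics, independently. -/
def step (h : ℕ → EuclideanSpace ℝ (Fin d) → EuclideanSpace ℝ (Fin d) → ℝ) (N Nt k : ℕ) [NeZero N]
    (B : Fin N → Kernel (Swarm d N × Cloud d N) (Fin N)) [∀ i, IsFiniteKernel (B i)] :
    Kernel (Swarm d N) (Swarm d N) :=
  (𝒜.mutation N k ⊗ₖ piKernel fun i : Fin N => statistic h N Nt k (B i) i).map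
    fun b i => ((b.1 i).1, (b.1 i).2, b.2 i)

/-- The initial particle system: independent particles drawn from `η₀`, with `τ_0 = 0`. -/
def initial (N : ℕ) : Measure (Swarm d N) :=
  Measure.pi fun _ : Fin N =>
    (M.μ.withDensity fun x => ENNReal.ofReal (𝒜.η₀ x)).map fun x => (x, 𝒜.weightInit x, (0 : ℝ))

/-- The law of the particle system at time `k`, when the backward indices at the step from time
`j` to time `j + 1` are drawn from `B j`. -/
def law (h : ℕ → EuclideanSpace ℝ (Fin d) → EuclideanSpace ℝ (Fin d) → ℝ) (N Nt : ℕ) [NeZero N]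
    (B : ℕ → Fin N → Kernel (Swarm d N × Cloud d N) (Fin N)) [∀ k i, IsFiniteKernel (B k i)] :
    ℕ → Measure (Swarm d N)
  | 0 => 𝒜.initial N
  | k + 1 => (law h N Nt B k).bind (𝒜.step h N Nt k (B k))

/-- The observation densities are positive and uniformly bounded. -/
def BoundedModel (M : Model d) : Prop :=
  (∀ k x, 0 < M.g k x) ∧ ⨆ k, supNorm (M.g k) < ⊤

/-- The adjustment multipliers, the proposal densities and the random importance weights are
uniformly bounded. -/
def BoundedAlgo : Prop :=
  (⨆ k, supNorm (𝒜.ϑ (k + 1))) < ⊤ ∧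
  (⨆ k, supNorm (Function.uncurry (𝒜.p (k + 1)))) < ⊤ ∧
  supNorm 𝒜.weightInit < ⊤ ∧
  (⨆ k, supNorm fun a : EuclideanSpace ℝ (Fin d) × EuclideanSpace ℝ (Fin d) × Z =>
    𝒜.weight k a.1 a.2.1 a.2.2) < ⊤

/-- `σ` is an admissible accept-reject bound for the step from time `k` to time `k + 1`: it
dominates `qhat_k(ξ_k^j, ξ_{k+1}^i; ζ)` for all `i`, `j` and `ζ`. As `qhat` is almost surely
positive, `σ` is then positive and the accept-reject loop terminates almost surely. -/
def Admissible {N : ℕ} (k : ℕ) (σ : Swarm d N × Cloud d N → ℝ) : Prop :=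
  ∀ a i j z, 𝒜.qhat k (a.1 j).1 (a.2 i).1 z ≤ σ a

end Algo

/-- The estimator `φ_k^N[τ_k] = ∑ᵢ ω̂_k^i τ_k^i / ∑ᵢ ω̂_k^i`. -/
def estimator {d N : ℕ} (s : Swarm d N) : ℝ :=
  (∑ i, (s i).2.1 * (s i).2.2) / ∑ i, (s i).2.1

end GRandPaRIS

end

/-!
The estimator is a ratio of two weighted means
`V_k(f, f') = N⁻¹ ∑ᵢ ω̂_k^i (τ_k^i f(ξ_k^i) + f'(ξ_k^i))` (`weightedMean`), and its target is the
ratio of the corresponding path integrals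
`Γ_k(f, f') = ∫ (H_k f(x_k) + f'(x_k)) × (joint density) dμ^{k+1}` (`Model.pathIntegral`). By
induction on `k`, every `V_k(f, f')` with bounded measurable `f`, `f'` concentrates at
`Γ_k(f, f') / c_k`, for a constant `c_k > 0` that does not depend on `f`, `f'`
(`Algo.expConcentrates_weightedMean`).

Two facts carry the induction. First, given the particles at time `k`, the new triples
(position, weight, statistic) are independent and identically distributed (`Algo.step_apply`): a
backward index sees only the new particle to which it belongs. For the accept-reject loop this holds
although the bound `σ̂` depends on all the particles, because `σ̂` cancels when the law of one trial
is conditioned on acceptance (`Algo.acceptRejectIndex_apply`), and what remains is the direct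
sampling law by unbiasedness of `q̂_k`. So both samplers satisfy one predicate
(`Algo.IsBackwardSampler`), and the constants are uniform over all samplers satisfying it. As the
new triples are bounded, Hoeffding's inequality (`pi_mean_deviation_le`) controls the deviation of
`V_{k+1}(f, f')` from its conditional mean.

Second, this conditional mean is the ratio `V_k(L_k f, L_k (h_k f + f')) / V_k(0, ϑ_{k+1})`, where
`L_k F(x) = ∫ q_k(x, y) g_{k+1}(y) F(x, y) μ(dy)` (`Algo.integral_newParticle`): averaging over the
backward draws produces `Λ_k^N`, whose denominator cancels against the mixture over the ancestors of
the new position. The induction hypothesis applies to both terms of the ratio, and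
`Γ_{k+1}(f, f') = Γ_k(L_k f, L_k (h_k f + f'))` (`Model.pathIntegral_succ`) identifies the limit.

A ratio `R = X / Y` of concentrating quantities is handled through `R B - A = R (B - Y) + (X - A)`
(`ExpConcentrates.ratio`), which uses only that `R` is bounded and `R Y = X`. No lower bound on the
random denominator is needed, and the event that all the weights vanish is harmless, since
`X = Y = 0` there.
-/

noncomputable section

namespace GRandPaRIS

/-! ### Bounded measurable functions -/

lemma abs_le_of_supNorm_le {α : Type*} {f : α → ℝ} {C : ℝ≥0∞} (h : supNorm f ≤ C) (hC : C < ⊤)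
    (x : α) : |f x| ≤ C.toReal := by
  rw [← Real.norm_eq_abs, ← toReal_enorm]
  exact ENNReal.toReal_mono hC.ne ((le_iSup (fun x => ‖f x‖ₑ) x).trans h)

/-- `f` is measurable and bounded. -/
structure BddMeas {α : Type*} [MeasurableSpace α] (f : α → ℝ) : Prop where
  meas : Measurable f
  bdd : ∃ C, 0 ≤ C ∧ ∀ x, |f x| ≤ C

namespace BddMeas

variable {α β : Type*} [MeasurableSpace α] [MeasurableSpace β] {f g : α → ℝ}

lemma const (c : ℝ) : BddMeas fun _ : α => c :=
  ⟨measurable_const, |c|, abs_nonneg c, fun _ => le_rfl⟩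

lemma add (hf : BddMeas f) (hg : BddMeas g) : BddMeas fun x => f x + g x := by
  obtain ⟨C, hC0, hC⟩ := hf.bdd
  obtain ⟨D, hD0, hD⟩ := hg.bdd
  exact ⟨hf.meas.add hg.meas, C + D, by positivity,
    fun x => (abs_add_le _ _).trans (add_le_add (hC x) (hD x))⟩

lemma mul (hf : BddMeas f) (hg : BddMeas g) : BddMeas fun x => f x * g x := by
  obtain ⟨C, hC0, hC⟩ := hf.bdd
  obtain ⟨D, hD0, hD⟩ := hg.bdd
  refine ⟨hf.meas.mul hg.meas, C * D, by positivity, fun x => ?_⟩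
  rw [abs_mul]
  exact mul_le_mul (hC x) (hD x) (abs_nonneg _) hC0

lemma sum {ι : Type*} {s : Finset ι} {F : ι → α → ℝ} (h : ∀ i ∈ s, BddMeas (F i)) :
    BddMeas fun x => ∑ i ∈ s, F i x := by
  classical
  induction s using Finset.induction_on with
  | empty => simpa using const 0
  | insert i s hi ih =>
    simp only [Finset.sum_insert hi]
    exact (h i (by simp)).add (ih fun j hj => h j (by simp [hj]))

lemma comp (hf : BddMeas f) {u : β → α} (hu : Measurable u) : BddMeas fun y => f (u y) :=
  ⟨hf.meas.comp hu, hf.bdd.imp fun _ h => ⟨h.1, fun y => h.2 (u y)⟩⟩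

lemma of_supNorm (hf : Measurable f) (h : supNorm f < ⊤) : BddMeas f :=
  ⟨hf, (supNorm f).toReal, ENNReal.toReal_nonneg, abs_le_of_supNorm_le le_rfl h⟩

lemma of_osc (x₀ : α) (hf : Measurable f) (h : osc f < ⊤) : BddMeas f := by
  refine ⟨hf, |f x₀| + (osc f).toReal, by positivity, fun x => ?_⟩
  have h1 : dist (f x) (f x₀) ≤ (osc f).toReal := by
    rw [dist_edist]
    exact ENNReal.toReal_mono h.ne
      (le_iSup_of_le (f := fun x => ⨆ x', edist (f x) (f x')) x
        (le_iSup (fun x' => edist (f x) (f x')) x₀))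
  rw [Real.dist_eq] at h1
  have := abs_add_le (f x₀) (f x - f x₀)
  rw [add_sub_cancel] at this
  linarith

lemma integrable (hf : BddMeas f) (ν : Measure α) [IsFiniteMeasure ν] : Integrable f ν := by
  obtain ⟨C, -, hC⟩ := hf.bdd
  exact Integrable.of_bound hf.meas.aestronglyMeasurable C (ae_of_all _ hC)

lemma mul_integrable (hf : BddMeas f) {ν : Measure α} (hg : Integrable g ν) :
    Integrable (fun x => g x * f x) ν := by
  obtain ⟨C, -, hC⟩ := hf.bdd
  exact hg.mul_bdd (c := C) hf.meas.aestronglyMeasurable (ae_of_all _ hC)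

end BddMeas

/-! ### Path integrals of the model -/

variable {d : ℕ}

local notation "E" => EuclideanSpace ℝ (Fin d)

namespace Model

variable (M : Model d)

lemma measurable_snoc {k : ℕ} :
    Measurable fun a : E × (Fin (k + 1) → E) =>
      (Fin.snoc (α := fun _ => E) a.2 a.1 : Fin (k + 2) → E) := by
  refine measurable_pi_lambda _ fun i => ?_
  refine Fin.lastCases ?_ (fun j => ?_) i
  · simpa using measurable_fst
  · simp only [Fin.snoc_castSucc]; fun_prop

/-- Paths of length `k + 2` are a path of length `k + 1` followed by a last point. -/
lemma measurePreserving_snoc (k : ℕ) :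
    MeasurePreserving (fun a : E × (Fin (k + 1) → E) =>
      (Fin.snoc (α := fun _ => E) a.2 a.1 : Fin (k + 2) → E))
      (M.μ.prod (Measure.pi fun _ => M.μ)) (Measure.pi fun _ => M.μ) := by
  have := (measurePreserving_piFinSuccAbove (fun _ : Fin (k + 2) => M.μ)
    (Fin.last (k + 1))).symm
  convert this using 1
  ext a i
  simp [MeasurableEquiv.piFinSuccAbove, Fin.insertNthEquiv, Fin.insertNth_last']

lemma lintegral_snoc (k : ℕ) {F : (Fin (k + 2) → E) → ℝ≥0∞} (hF : Measurable F) :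
    ∫⁻ x, F x ∂(Measure.pi fun _ => M.μ) =
      ∫⁻ x, ∫⁻ y, F (Fin.snoc (α := fun _ => E) x y) ∂M.μ
        ∂(Measure.pi fun _ : Fin (k + 1) => M.μ) := by
  rw [← (M.measurePreserving_snoc k).lintegral_comp hF, lintegral_prod_symm]
  exact (hF.comp measurable_snoc).aemeasurable

lemma integral_snoc (k : ℕ) {F : (Fin (k + 2) → E) → ℝ}
    (hF : Integrable F (Measure.pi fun _ => M.μ)) :
    ∫ x, F x ∂(Measure.pi fun _ => M.μ) =
      ∫ x, ∫ y, F (Fin.snoc (α := fun _ => E) x y) ∂M.μ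
        ∂(Measure.pi fun _ : Fin (k + 1) => M.μ) := by
  rw [← (M.measurePreserving_snoc k).map_eq] at hF ⊢
  rw [integral_map measurable_snoc.aemeasurable hF.1]
  exact integral_prod_symm _ ((integrable_map_measure hF.1 measurable_snoc.aemeasurable).1 hF)

lemma jointDensity_snoc (k : ℕ) (x : Fin (k + 1) → E) (y : E) :
    M.jointDensity (k + 1) (Fin.snoc (α := fun _ => E) x y) =
      M.jointDensity k x * (M.q k (x (Fin.last k)) y * M.g (k + 1) y) := by
  unfold jointDensity
  rw [Fin.prod_univ_castSucc (n := k), Fin.prod_univ_castSucc (n := k + 1)]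
  have h0 : (Fin.snoc (α := fun _ => E) x y : Fin (k + 2) → E) 0 = x 0 := by
    rw [← Fin.castSucc_zero, Fin.snoc_castSucc]
  have hs : ∀ j : Fin k, (Fin.snoc (α := fun _ => E) x y : Fin (k + 2) → E) j.castSucc.succ
      = x j.succ := fun j => by
    rw [Fin.succ_castSucc, Fin.snoc_castSucc]
  simp only [h0, hs, Fin.snoc_castSucc, Fin.succ_last, Fin.snoc_last, Fin.val_castSucc,
    Fin.val_last]
  ring

lemma jointDensity_nonneg (k : ℕ) (x : Fin (k + 1) → E) : 0 ≤ M.jointDensity k x :=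
  mul_nonneg (mul_nonneg (M.χ_nonneg _) (Finset.prod_nonneg fun _ _ => M.q_nonneg _ _ _))
    (Finset.prod_nonneg fun _ _ => M.g_nonneg _ _)

lemma measurable_jointDensity (k : ℕ) : Measurable (M.jointDensity k) := by
  unfold jointDensity
  refine Measurable.mul (Measurable.mul (M.χ_meas.comp (by fun_prop)) ?_) ?_
  · exact Finset.measurable_prod _ fun j _ => (M.q_meas j).comp
      (by fun_prop : Measurable fun x : Fin (k + 1) → E => (x j.castSucc, x j.succ))
  · exact Finset.measurable_prod _ fun j _ => (M.g_meas j).comp (by fun_prop)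

lemma integrable_χ : Integrable M.χ M.μ :=
  ⟨M.χ_meas.aestronglyMeasurable, by
    rw [hasFiniteIntegral_iff_ofReal (ae_of_all _ M.χ_nonneg), M.χ_density]; simp⟩

lemma integrable_q (k : ℕ) (x : E) : Integrable (M.q k x) M.μ :=
  ⟨((M.q_meas k).comp measurable_prodMk_left).aestronglyMeasurable, by
    rw [hasFiniteIntegral_iff_ofReal (ae_of_all _ (M.q_nonneg k x)), M.q_density]; simp⟩

lemma integral_q (k : ℕ) (x : E) : ∫ y, M.q k x y ∂M.μ = 1 := by
  rw [integral_eq_lintegral_of_nonneg_ae (ae_of_all _ (M.q_nonneg k x))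
    ((M.q_meas k).comp measurable_prodMk_left).aestronglyMeasurable, M.q_density]
  simp

lemma measurePreserving_pi_one :
    MeasurePreserving (MeasurableEquiv.funUnique (Fin 1) E).symm M.μ
      (Measure.pi fun _ : Fin 1 => M.μ) := by
  convert (measurePreserving_funUnique M.μ (Fin 1)).symm using 1
  congr 1

lemma lintegral_pi_one (F : (Fin 1 → E) → ℝ≥0∞) :
    ∫⁻ x, F x ∂(Measure.pi fun _ => M.μ) = ∫⁻ y, F (fun _ => y) ∂M.μ := by
  rw [← M.measurePreserving_pi_one.map_eq, lintegral_map_equiv]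
  rfl

lemma integral_pi_one (F : (Fin 1 → E) → ℝ) :
    ∫ x, F x ∂(Measure.pi fun _ => M.μ) = ∫ y, F (fun _ => y) ∂M.μ := by
  rw [← M.measurePreserving_pi_one.map_eq, integral_map_equiv]
  rfl

lemma jointDensity_zero (y : E) : M.jointDensity 0 (fun _ => y) = M.χ y * M.g 0 y := by
  simp [jointDensity]

lemma integrable_jointDensity (hg : ∀ k, BddMeas (M.g k)) (k : ℕ) :
    Integrable (M.jointDensity k) (Measure.pi fun _ => M.μ) := by
  refine ⟨(M.measurable_jointDensity k).aestronglyMeasurable, ?_⟩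
  rw [hasFiniteIntegral_iff_ofReal (ae_of_all _ (M.jointDensity_nonneg k))]
  induction k with
  | zero =>
    rw [lintegral_pi_one]
    simp only [jointDensity_zero]
    rw [← hasFiniteIntegral_iff_ofReal
      (ae_of_all _ fun x => mul_nonneg (M.χ_nonneg x) (M.g_nonneg 0 x))]
    exact ((hg 0).mul_integrable M.integrable_χ).2
  | succ k ih =>
    rw [M.lintegral_snoc k (M.measurable_jointDensity _).ennreal_ofReal]
    obtain ⟨C, hC0, hC⟩ := (hg (k + 1)).bdd
    calc _ ≤ ∫⁻ x, ENNReal.ofReal (M.jointDensity k x) * ENNReal.ofReal C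
            ∂(Measure.pi fun _ => M.μ) := by
          refine lintegral_mono fun x => ?_
          have h1 : ∀ y, ENNReal.ofReal (M.jointDensity (k + 1) (Fin.snoc (α := fun _ => E) x y))
              ≤ ENNReal.ofReal (M.jointDensity k x) * ENNReal.ofReal C *
                ENNReal.ofReal (M.q k (x (Fin.last k)) y) := fun y => by
            rw [jointDensity_snoc, ← ENNReal.ofReal_mul (M.jointDensity_nonneg _ _),
              ← ENNReal.ofReal_mul (mul_nonneg (M.jointDensity_nonneg _ _) hC0)]
            refine ENNReal.ofReal_le_ofReal ?_
            rw [mul_assoc, mul_comm C]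
            exact mul_le_mul_of_nonneg_left (mul_le_mul_of_nonneg_left
              ((le_abs_self _).trans (hC y)) (M.q_nonneg _ _ _)) (M.jointDensity_nonneg _ _)
          refine (lintegral_mono h1).trans ?_
          have hm : Measurable (M.q k (x (Fin.last k))) := (M.q_meas k).of_uncurry_left
          rw [lintegral_const_mul _ hm.ennreal_ofReal]
          simp [M.q_density]
      _ < ⊤ := by
          rw [lintegral_mul_const _ (M.measurable_jointDensity k).ennreal_ofReal]
          exact ENNReal.mul_lt_top ih ENNReal.ofReal_lt_top

/-- The unnormalized one-step operator `L_k F(x) = ∫ q_k(x, y) g_{k+1}(y) F(x, y) μ(dy)`. -/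
def forward (k : ℕ) (F : E → E → ℝ) (x : E) : ℝ := ∫ y, M.q k x y * M.g (k + 1) y * F x y ∂M.μ

/-- The unnormalized expectation of `H_k f(x_k) + f'(x_k)` under the joint density of the hidden
path and of the observations up to time `k`. -/
def pathIntegral (h : ℕ → E → E → ℝ) (k : ℕ) (f f' : E → ℝ) : ℝ :=
  ∫ x, M.jointDensity k x * (additive h k x * f (x (Fin.last k)) + f' (x (Fin.last k)))
    ∂(Measure.pi fun _ => M.μ)

variable {M}

lemma integrable_forward (hg : ∀ k, BddMeas (M.g k)) (k : ℕ) {F : E → E → ℝ}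
    (hF : BddMeas (Function.uncurry F)) (x : E) :
    Integrable (fun y => M.q k x y * M.g (k + 1) y * F x y) M.μ :=
  (hF.comp measurable_prodMk_left : BddMeas fun y => F x y).mul_integrable
    ((hg (k + 1)).mul_integrable (M.integrable_q k x))

lemma bddMeas_forward (hg : ∀ k, BddMeas (M.g k)) (k : ℕ) {F : E → E → ℝ}
    (hF : BddMeas (Function.uncurry F)) : BddMeas (M.forward k F) := by
  obtain ⟨C, hC0, hC⟩ := (hg (k + 1)).bdd
  obtain ⟨D, hD0, hD⟩ := hF.bdd
  refine ⟨?_, C * D, by positivity, fun x => ?_⟩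
  · refine (StronglyMeasurable.integral_prod_right (ν := M.μ)
      (f := fun x y => M.q k x y * M.g (k + 1) y * F x y) ?_).measurable
    exact Measurable.stronglyMeasurable
      (((M.q_meas k).mul ((M.g_meas (k + 1)).comp measurable_snd)).mul hF.meas)
  · have h1 : ‖M.forward k F x‖ ≤ ∫ y, M.q k x y * (C * D) ∂M.μ := by
      refine norm_integral_le_of_norm_le ((M.integrable_q k x).mul_const _)
        (ae_of_all _ fun y => ?_)
      rw [Real.norm_eq_abs, abs_mul, abs_mul, mul_assoc, abs_of_nonneg (M.q_nonneg k x y)]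
      exact mul_le_mul_of_nonneg_left (mul_le_mul (hC y) (hD (x, y)) (abs_nonneg _) hC0)
        (M.q_nonneg k x y)
    rwa [integral_mul_const, M.integral_q, one_mul, Real.norm_eq_abs] at h1

lemma forward_pos (hg : ∀ k, BddMeas (M.g k)) (hgpos : ∀ k x, 0 < M.g k x)
    (hq : ∀ k x y, 0 < M.q k x y) (k : ℕ) {F : E → E → ℝ} (hF : BddMeas (Function.uncurry F))
    (hpos : ∀ x y, 0 < F x y) (x : E) : 0 < M.forward k F x := by
  have hp : ∀ y, 0 < M.q k x y * M.g (k + 1) y * F x y := fun y =>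
    mul_pos (mul_pos (hq k x y) (hgpos _ y)) (hpos x y)
  unfold forward
  rw [integral_pos_iff_support_of_nonneg (fun y => (hp y).le) (integrable_forward hg k hF x)]
  have : (Function.support fun y => M.q k x y * M.g (k + 1) y * F x y) = Set.univ :=
    Set.eq_univ_of_forall fun y => (hp y).ne'
  rw [this, pos_iff_ne_zero]
  intro h0
  have := M.q_density k x
  rw [Measure.measure_univ_eq_zero.1 h0] at this
  simp at this

end Model

variable {M : Model d}

lemma additive_snoc (h : ℕ → E → E → ℝ) (k : ℕ) (x : Fin (k + 1) → E) (y : E) :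
    additive h (k + 1) (Fin.snoc (α := fun _ => E) x y) =
      additive h k x + h k (x (Fin.last k)) y := by
  unfold additive
  rw [Fin.sum_univ_castSucc (n := k)]
  have hs : ∀ j : Fin k, (Fin.snoc (α := fun _ => E) x y : Fin (k + 2) → E) j.castSucc.succ
      = x j.succ := fun j => by
    rw [Fin.succ_castSucc, Fin.snoc_castSucc]
  simp only [hs, Fin.snoc_castSucc, Fin.succ_last, Fin.snoc_last, Fin.val_castSucc,
    Fin.val_last]

lemma bddMeas_additive {h : ℕ → E → E → ℝ} {k : ℕ}
    (hh : ∀ j < k, BddMeas (Function.uncurry (h j))) : BddMeas (additive (d := d) h k) :=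
  BddMeas.sum fun j _ => (hh j j.2).comp
    (by fun_prop : Measurable fun x : Fin (k + 1) → E => (x j.castSucc, x j.succ))

namespace Model

lemma integrable_pathIntegral (hg : ∀ k, BddMeas (M.g k)) {h : ℕ → E → E → ℝ} {k : ℕ}
    (hh : ∀ j < k, BddMeas (Function.uncurry (h j))) {f f' : E → ℝ} (hf : BddMeas f)
    (hf' : BddMeas f') :
    Integrable (fun x : Fin (k + 1) → E => M.jointDensity k x *
      (additive h k x * f (x (Fin.last k)) + f' (x (Fin.last k)))) (Measure.pi fun _ => M.μ) :=
  (((bddMeas_additive hh).mul (hf.comp (measurable_pi_apply _))).add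
    (hf'.comp (measurable_pi_apply _))).mul_integrable (M.integrable_jointDensity hg k)

lemma pathIntegral_zero (h : ℕ → E → E → ℝ) (f f' : E → ℝ) :
    M.pathIntegral h 0 f f' = ∫ y, M.χ y * M.g 0 y * f' y ∂M.μ := by
  unfold pathIntegral
  rw [integral_pi_one]
  simp [jointDensity_zero, additive]

/-- Integrating out the last point of the path: the forward recursion of the additive smoother. -/
lemma pathIntegral_succ (hg : ∀ k, BddMeas (M.g k)) {h : ℕ → E → E → ℝ} {k : ℕ}
    (hh : ∀ j < k + 1, BddMeas (Function.uncurry (h j))) {f f' : E → ℝ} (hf : BddMeas f)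
    (hf' : BddMeas f') :
    M.pathIntegral h (k + 1) f f' = M.pathIntegral h k (M.forward k fun _ y => f y)
      (M.forward k fun x y => h k x y * f y + f' y) := by
  unfold pathIntegral
  rw [M.integral_snoc k (integrable_pathIntegral hg hh hf hf')]
  congr 1
  ext x
  simp only [jointDensity_snoc, additive_snoc, Fin.snoc_last]
  have h1 := integrable_forward hg k (F := fun _ y => f y) (hf.comp measurable_snd)
    (x (Fin.last k))
  have h2 := integrable_forward hg k (F := fun x y => h k x y * f y + f' y)
    (((hh k (by omega)).mul (hf.comp measurable_snd)).add (hf'.comp measurable_snd))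
    (x (Fin.last k))
  unfold forward
  rw [← integral_const_mul, ← integral_add (h1.const_mul _) h2, ← integral_const_mul]
  congr 1
  ext y
  ring

lemma pathIntegral_pos (hg : ∀ k, BddMeas (M.g k)) (hgpos : ∀ k x, 0 < M.g k x)
    (hq : ∀ k x y, 0 < M.q k x y) (h : ℕ → E → E → ℝ) (k : ℕ) {f : E → ℝ} (hf : BddMeas f)
    (hpos : ∀ x, 0 < f x) : 0 < M.pathIntegral h k (fun _ => 0) f := by
  -- the additive functional is irrelevant here, so it may be replaced by a bounded one
  have h0 : M.pathIntegral h k (fun _ => 0) f =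
      M.pathIntegral (fun _ _ _ => 0) k (fun _ => 0) f := by
    simp [pathIntegral]
  rw [h0]
  clear h0
  induction k generalizing f with
  | zero =>
    rw [pathIntegral_zero]
    have hnn : ∀ y, 0 ≤ M.χ y * M.g 0 y * f y := fun y =>
      mul_nonneg (mul_nonneg (M.χ_nonneg y) (M.g_nonneg 0 y)) (hpos y).le
    rw [integral_pos_iff_support_of_nonneg hnn
      (hf.mul_integrable ((hg 0).mul_integrable M.integrable_χ))]
    have hs : (Function.support fun y => M.χ y * M.g 0 y * f y) = Function.support M.χ := by
      ext y
      simp [(hgpos 0 y).ne', (hpos y).ne']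
    rw [hs, ← integral_pos_iff_support_of_nonneg M.χ_nonneg M.integrable_χ,
      integral_eq_lintegral_of_nonneg_ae (ae_of_all _ M.χ_nonneg)
        M.χ_meas.aestronglyMeasurable, M.χ_density]
    simp
  | succ k ih =>
    rw [pathIntegral_succ hg (fun _ _ => BddMeas.const 0) (BddMeas.const 0) hf]
    have h1 : (M.forward k fun _ _ => (0 : ℝ)) = fun _ => 0 := by
      ext x; simp [forward]
    simp only [zero_mul, zero_add, h1]
    exact ih (bddMeas_forward hg k (F := fun _ y => f y) (hf.comp measurable_snd))
      (forward_pos hg hgpos hq k (F := fun _ y => f y) (hf.comp measurable_snd)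
        fun _ y => hpos y)

/-- By the tower property, the target is the smoothed expectation of the additive functional,
which is a ratio of path integrals. -/
lemma integral_T_additive (hg : ∀ k, BddMeas (M.g k)) (hgpos : ∀ k x, 0 < M.g k x)
    (hq : ∀ k x y, 0 < M.q k x y) {h : ℕ → E → E → ℝ} {k : ℕ}
    (hh : ∀ j < k, BddMeas (Function.uncurry (h j))) :
    ∫ x, M.T k (additive h k) x ∂M.filter k =
      M.pathIntegral h k (fun _ => 1) (fun _ => 0) /
        M.pathIntegral h k (fun _ => 0) (fun _ => 1) := by
  have hH := bddMeas_additive hh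
  have h1 : ∫ x, M.T k (additive h k) x ∂M.filter k =
      ∫ x, additive h k x ∂M.smoothing k := by
    have hlast : Measurable fun p : Fin (k + 1) → E => p (Fin.last k) := measurable_pi_apply _
    have hc : (M.filter k) ⊗ₘ condDistrib id (fun p => p (Fin.last k)) (M.smoothing k) =
        (M.smoothing k).map fun p => (p (Fin.last k), p) :=
      compProd_map_condDistrib (Y := id) aemeasurable_id
    have : IsFiniteMeasure (M.filter k) := by unfold filter; infer_instance
    have hi := Measure.integral_compProd (μ := M.filter k)
      (κ := condDistrib id (fun p => p (Fin.last k)) (M.smoothing k))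
      (f := fun a => additive h k a.2) ((hH.comp measurable_snd).integrable _)
    rw [hc, integral_map (hlast.prodMk measurable_id').aemeasurable
      (hH.comp measurable_snd).meas.aestronglyMeasurable] at hi
    exact hi.symm
  have hJ := M.integrable_jointDensity hg k
  have hden : M.pathIntegral h k (fun _ => 0) (fun _ => 1) =
      ∫ x, M.jointDensity k x ∂(Measure.pi fun _ => M.μ) := by simp [pathIntegral]
  have hmass : ((Measure.pi fun _ : Fin (k + 1) => M.μ).withDensity
      fun x => ENNReal.ofReal (M.jointDensity k x)) Set.univ =
      ENNReal.ofReal (M.pathIntegral h k (fun _ => 0) (fun _ => 1)) := by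
    rw [withDensity_apply _ MeasurableSet.univ, Measure.restrict_univ, hden,
      ofReal_integral_eq_lintegral_ofReal hJ (ae_of_all _ (M.jointDensity_nonneg k))]
  have hpos := pathIntegral_pos hg hgpos hq h k (BddMeas.const 1) fun _ => one_pos
  rw [h1, smoothing, ProbabilityTheory.cond, Measure.restrict_univ, hmass, integral_smul_measure,
    integral_withDensity_eq_integral_toReal_smul (M.measurable_jointDensity k).ennreal_ofReal
      (ae_of_all _ fun _ => ENNReal.ofReal_lt_top), ENNReal.toReal_inv,
    ENNReal.toReal_ofReal hpos.le, smul_eq_mul, inv_mul_eq_div]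
  congr 1
  unfold pathIntegral
  congr 1
  ext x
  simp [ENNReal.toReal_ofReal (M.jointDensity_nonneg k x)]

end Model

/-! ### Categorical draws and accept-reject loops -/

lemma categorical_apply {N : ℕ} (w : Fin N → ℝ) :
    categorical N w = ∑ j, proportional w j • Measure.dirac j := rfl

lemma lintegral_categorical {N : ℕ} (w : Fin N → ℝ) (F : Fin N → ℝ≥0∞) :
    ∫⁻ j, F j ∂categorical N w = ∑ j, proportional w j * F j := by
  rw [categorical_apply, lintegral_finsetSum_measure]
  simp

lemma categorical_singleton {N : ℕ} (w : Fin N → ℝ) (m : Fin N) :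
    categorical N w {m} = proportional w m := by
  rw [← lintegral_indicator_one (measurableSet_singleton m), lintegral_categorical]
  simp [Set.indicator_apply]

lemma proportional_le_one {N : ℕ} [NeZero N] (w : Fin N → ℝ) (j : Fin N) :
    proportional w j ≤ 1 := by
  rw [← sum_proportional w]
  exact Finset.single_le_sum (f := fun j => proportional w j) (fun _ _ => zero_le)
    (Finset.mem_univ j)

lemma toReal_proportional {N : ℕ} {w : Fin N → ℝ} (hw : ∀ j, 0 ≤ w j) (hs : 0 < ∑ j, w j)
    (m : Fin N) : (proportional w m).toReal = w m / ∑ j, w j := by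
  unfold proportional
  rw [← ENNReal.ofReal_sum_of_nonneg fun i _ => hw i,
    if_neg (by simpa using hs), ← ENNReal.ofReal_div_of_pos hs,
    ENNReal.toReal_ofReal (div_nonneg (hw m) hs.le)]

/-- The output of an accept-reject loop has the law of one trial conditioned on acceptance. -/
lemma acceptReject_apply {α β : Type*} [MeasurableSpace α] [MeasurableSpace β]
    (κ : Kernel α β) [IsMarkovKernel κ] {A : Set (α × β)} (hA : MeasurableSet A) (a : α)
    {s : Set β} (hs : MeasurableSet s) :
    acceptReject κ A hA a s =
      (κ a {b | (a, b) ∈ A})⁻¹ * κ a (s ∩ {b | (a, b) ∈ A}) := by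
  have hm : MeasurableSet {b | (a, b) ∈ A} := hA.preimage measurable_prodMk_left
  change (Measure.sum fun m : ℕ =>
    (κ a {b | (a, b) ∉ A}) ^ m • (κ a).restrict {b | (a, b) ∈ A}) s = _
  have hc : κ a {b | (a, b) ∉ A} = 1 - κ a {b | (a, b) ∈ A} := prob_compl_eq_one_sub hm
  simp only [Measure.sum_apply _ hs, Measure.smul_apply, Measure.restrict_apply hs, smul_eq_mul]
  rw [ENNReal.tsum_mul_right, ENNReal.tsum_geometric, hc,
    ENNReal.sub_sub_cancel ENNReal.one_ne_top prob_le_one]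

lemma uniform_Iic_apply {c : ℝ} (hc : c ≤ 1) :
    volume.restrict (Set.Icc (0 : ℝ) 1) {u | u ≤ c} = ENNReal.ofReal c := by
  change volume.restrict (Set.Icc (0 : ℝ) 1) (Set.Iic c) = _
  rw [Measure.restrict_apply measurableSet_Iic]
  have : Set.Iic c ∩ Set.Icc (0 : ℝ) 1 = Set.Icc 0 c := by
    ext u
    simp only [Set.mem_inter_iff, Set.mem_Iic, Set.mem_Icc]
    exact ⟨fun h => ⟨h.2.1, h.1⟩, fun h => ⟨h.2, h.1, h.2.trans hc⟩⟩
  rw [this, Real.volume_Icc, sub_zero]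

variable {Z : Type*} [MeasurableSpace Z]

/-! ### Backward samplers -/

namespace Algo

/-- The almost sure positivity of the unbiased estimator makes the transition density positive
everywhere. -/
lemma q_pos (𝒜 : Algo M Z) (k : ℕ) (x y : E) : 0 < M.q k x y := by
  rw [← 𝒜.qhat_unbiased k x y]
  refine (integral_pos_iff_support_of_nonneg_ae ((𝒜.qhat_pos k x y).mono fun z hz => hz.le)
    (𝒜.qhat_integrable k x y)).2 ?_
  have h1 : 𝒜.ζlaw k (x, y) (Function.support (𝒜.qhat k x y)) = 1 := by
    rw [← measure_univ (μ := 𝒜.ζlaw k (x, y))]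
    refine measure_congr ?_
    filter_upwards [𝒜.qhat_pos k x y] with z hz
    exact propext ⟨fun _ => trivial, fun _ => hz.ne'⟩
  rw [h1]
  exact one_pos

/-- What the analysis of the algorithm needs from a family of backward samplers at the step from
time `k` to time `k + 1`: the law of the index attached to the `i`-th new particle depends on the
new particles only through the `i`-th one, and has the prescribed probabilities
`Λ_k^N(i, ·)` as soon as the weights are nonnegative and do not all vanish. The first property is
expressed by comparison with the sampler of index `0`, applied to new particles that are all equal
to the `i`-th one. -/
structure IsBackwardSampler (M : Model d) {N : ℕ} [NeZero N] (k : ℕ)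
    (B : Fin N → Kernel (Swarm d N × Cloud d N) (Fin N)) : Prop where
  markov : ∀ i, IsMarkovKernel (B i)
  congr : ∀ i a, B i a = B 0 (a.1, fun _ => a.2 i)
  mass : ∀ i a, (∀ j, 0 ≤ (a.1 j).2.1) → 0 < ∑ j, (a.1 j).2.1 → ∀ m,
    (B i a).real {m} = (a.1 m).2.1 * M.q k (a.1 m).1 (a.2 i).1 /
      ∑ j, (a.1 j).2.1 * M.q k (a.1 j).1 (a.2 i).1

lemma sum_weight_mul_pos {N : ℕ} {w q : Fin N → ℝ} (hw : ∀ j, 0 ≤ w j) (hs : 0 < ∑ j, w j)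
    (hq : ∀ j, 0 < q j) : 0 < ∑ j, w j * q j := by
  obtain ⟨j, hj, hj'⟩ := Finset.exists_ne_zero_of_sum_ne_zero hs.ne'
  exact Finset.sum_pos' (fun i _ => mul_nonneg (hw i) (hq i).le)
    ⟨j, hj, mul_pos (lt_of_le_of_ne (hw j) hj'.symm) (hq j)⟩

lemma isBackwardSampler_backwardIndex (hq : ∀ k x y, 0 < M.q k x y) (N k : ℕ) [NeZero N] :
    IsBackwardSampler M k (backwardIndex M N k) where
  markov _ := inferInstance
  congr _ _ := rfl
  mass i a hw hs m := by
    have h1 := categorical_singleton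
      (fun j => (a.1 j).2.1 * M.q k (a.1 j).1 (a.2 i).1) m
    have h2 := sum_weight_mul_pos hw hs fun j => hq k (a.1 j).1 (a.2 i).1
    rw [← toReal_proportional (fun j => mul_nonneg (hw j) (hq _ _ _).le) h2, ← h1]
    rfl

variable (𝒜 : Algo M Z)

lemma Admissible.pos {N : ℕ} [NeZero N] {k : ℕ} {σ : Swarm d N × Cloud d N → ℝ}
    (hσ : 𝒜.Admissible k σ) (a : Swarm d N × Cloud d N) : 0 < σ a := by
  obtain ⟨z, hz⟩ := (𝒜.qhat_pos k (a.1 0).1 (a.2 0).1).exists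
  exact hz.trans_le (hσ a 0 0 z)

/-- A trial of the accept-reject loop returns the index `m` and is accepted with a probability
proportional to `q_k(ξ_k^m, ξ_{k+1}^i)`, by unbiasedness. -/
lemma trial_apply {N k : ℕ} [NeZero N] {σ : Swarm d N × Cloud d N → ℝ} (hσm : Measurable σ)
    (hσ : 𝒜.Admissible k σ) (i : Fin N) (a : Swarm d N × Cloud d N) (m : Fin N) :
    𝒜.trial N k i a (Prod.fst ⁻¹' {m} ∩ {b | (a, b) ∈ 𝒜.acceptSet N k σ i}) =
      proportional (fun j => (a.1 j).2.1) m * ENNReal.ofReal (M.q k (a.1 m).1 (a.2 i).1) *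
        (ENNReal.ofReal (σ a))⁻¹ := by
  have : IsProbabilityMeasure (volume.restrict (Set.Icc (0 : ℝ) 1)) := ⟨by simp⟩
  have hS : MeasurableSet {b | (a, b) ∈ 𝒜.acceptSet N k σ i} :=
    (𝒜.measurableSet_acceptSet N k hσm i).preimage measurable_prodMk_left
  have hσ0 := Admissible.pos 𝒜 hσ a
  unfold trial
  rw [Kernel.compProd_apply ((measurable_fst (measurableSet_singleton m)).inter hS),
    Kernel.comap_apply, lintegral_categorical, Finset.sum_eq_single m]
  rotate_left
  · intro j _ hj
    have : (Prod.mk j ⁻¹' (Prod.fst ⁻¹' {m} ∩ {b | (a, b) ∈ 𝒜.acceptSet N k σ i}) :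
        Set (Z × ℝ)) = ∅ := by
      ext b; simp [hj]
    simp [this]
  · simp
  rw [mul_assoc]
  congr 1
  have hset : (Prod.mk m ⁻¹' (Prod.fst ⁻¹' {m} ∩ {b | (a, b) ∈ 𝒜.acceptSet N k σ i}) :
      Set (Z × ℝ)) = {b | b.2 ≤ 𝒜.qhat k (a.1 m).1 (a.2 i).1 b.1 / σ a} := by
    ext b; simp [acceptSet]
  have hqm : Measurable (𝒜.qhat k (a.1 m).1 (a.2 i).1) :=
    (𝒜.qhat_meas k).comp (measurable_prodMk_left (x := ((a.1 m).1, (a.2 i).1)))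
  have hqs : MeasurableSet
      {b : Z × ℝ | b.2 ≤ 𝒜.qhat k (a.1 m).1 (a.2 i).1 b.1 / σ a} :=
    measurableSet_le measurable_snd ((hqm.comp measurable_fst).div_const _)
  rw [hset, Kernel.prod_apply, Measure.prod_apply hqs, Kernel.comap_apply, Kernel.const_apply]
  have h1 : ∀ z, volume.restrict (Set.Icc (0 : ℝ) 1) (Prod.mk z ⁻¹'
      {b : Z × ℝ | b.2 ≤ 𝒜.qhat k (a.1 m).1 (a.2 i).1 b.1 / σ a}) =
      ENNReal.ofReal (𝒜.qhat k (a.1 m).1 (a.2 i).1 z) * (ENNReal.ofReal (σ a))⁻¹ := fun z => by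
    rw [← div_eq_mul_inv, ← ENNReal.ofReal_div_of_pos hσ0]
    exact uniform_Iic_apply ((div_le_one hσ0).2 (hσ a i m z))
  simp only [h1]
  rw [lintegral_mul_const _ hqm.ennreal_ofReal, ← ofReal_integral_eq_lintegral_ofReal
    (𝒜.qhat_integrable k _ _) ((𝒜.qhat_pos k _ _).mono fun z hz => hz.le), 𝒜.qhat_unbiased]

lemma acceptRejectIndex_apply {N k : ℕ} [NeZero N] {σ : Swarm d N × Cloud d N → ℝ}
    (hσm : Measurable σ) (hσ : 𝒜.Admissible k σ) (i : Fin N) (a : Swarm d N × Cloud d N)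
    (s : Set (Fin N)) :
    𝒜.acceptRejectIndex N k σ hσm i a s =
      (∑ m, proportional (fun j => (a.1 j).2.1) m *
        ENNReal.ofReal (M.q k (a.1 m).1 (a.2 i).1))⁻¹ *
      ∑ m, s.indicator (fun m => proportional (fun j => (a.1 j).2.1) m *
        ENNReal.ofReal (M.q k (a.1 m).1 (a.2 i).1)) m := by
  classical
  have hσ0 := Admissible.pos 𝒜 hσ a
  have hS : MeasurableSet {b | (a, b) ∈ 𝒜.acceptSet N k σ i} :=
    (𝒜.measurableSet_acceptSet N k hσm i).preimage measurable_prodMk_left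
  -- the mass of the accepted trials whose index lies in a given set
  have key : ∀ s : Set (Fin N), 𝒜.trial N k i a
      (Prod.fst ⁻¹' s ∩ {b | (a, b) ∈ 𝒜.acceptSet N k σ i}) =
      (∑ m, s.indicator (fun m => proportional (fun j => (a.1 j).2.1) m *
        ENNReal.ofReal (M.q k (a.1 m).1 (a.2 i).1)) m) * (ENNReal.ofReal (σ a))⁻¹ := fun s => by
    have hU : (Prod.fst ⁻¹' s ∩ {b | (a, b) ∈ 𝒜.acceptSet N k σ i} : Set (Fin N × Z × ℝ)) =
        ⋃ m ∈ s.toFinset, (Prod.fst ⁻¹' {m} ∩ {b | (a, b) ∈ 𝒜.acceptSet N k σ i}) := by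
      ext b
      simp
    rw [hU, measure_biUnion_finset]
    · simp only [𝒜.trial_apply hσm hσ, ← Finset.sum_mul]
      congr 1
      rw [← Finset.sum_filter_add_sum_filter_not Finset.univ (· ∈ s)]
      rw [Finset.sum_congr rfl fun m hm => Set.indicator_of_mem (Finset.mem_filter.1 hm).2 _,
        Finset.sum_eq_zero fun m hm => Set.indicator_of_notMem (Finset.mem_filter.1 hm).2 _,
        add_zero]
      exact Finset.sum_congr (by ext; simp) fun _ _ => rfl
    · intro m _ m' _ hne
      refine Set.disjoint_left.2 fun b hb hb' => hne ?_
      rw [← show b.1 = m from hb.1, ← show b.1 = m' from hb'.1]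
    · exact fun m _ => (measurable_fst (measurableSet_singleton m)).inter hS
  have hu := key Set.univ
  simp only [Set.preimage_univ, Set.univ_inter, Set.indicator_univ] at hu
  unfold acceptRejectIndex
  rw [Kernel.map_apply' _ measurable_fst _ (.of_discrete),
    acceptReject_apply _ _ _ (measurable_fst .of_discrete), key s, hu]
  have hc0 : (ENNReal.ofReal (σ a))⁻¹ ≠ 0 := ENNReal.inv_ne_zero.2 ENNReal.ofReal_ne_top
  have hct : (ENNReal.ofReal (σ a))⁻¹ ≠ ⊤ := ENNReal.inv_ne_top.2 (by simpa using hσ0)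
  rw [ENNReal.mul_inv (.inr hct) (.inr hc0), mul_comm (∑ m, s.indicator _ m), ← mul_assoc,
    mul_assoc _ _ (ENNReal.ofReal (σ a))⁻¹, ENNReal.inv_mul_cancel hc0 hct, mul_one]

lemma isBackwardSampler_acceptRejectIndex {N k : ℕ} [NeZero N]
    {σ : Swarm d N × Cloud d N → ℝ} (hσm : Measurable σ) (hσ : 𝒜.Admissible k σ) :
    IsBackwardSampler M k (𝒜.acceptRejectIndex N k σ hσm) where
  markov i := by
    refine ⟨fun a => ⟨?_⟩⟩
    rw [acceptRejectIndex_apply 𝒜 hσm hσ]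
    simp only [Set.indicator_univ]
    refine ENNReal.inv_mul_cancel ?_ ?_
    · intro h0
      have h1 := sum_proportional fun j => (a.1 j).2.1
      rw [Finset.sum_eq_zero fun m hm => ?_] at h1
      · exact zero_ne_one h1
      · refine (mul_eq_zero.1 (Finset.sum_eq_zero_iff.1 h0 m hm)).resolve_right ?_
        simpa using 𝒜.q_pos k _ _
    · exact (ENNReal.sum_lt_top.2 fun m _ => ENNReal.mul_lt_top
        ((proportional_le_one _ _).trans_lt ENNReal.one_lt_top) ENNReal.ofReal_lt_top).ne
  congr i a := by
    ext s -
    rw [acceptRejectIndex_apply 𝒜 hσm hσ, acceptRejectIndex_apply 𝒜 hσm hσ]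
  mass i a hw hs m := by
    rw [measureReal_def, acceptRejectIndex_apply 𝒜 hσm hσ]
    have h1 : ∀ j, proportional (fun j => (a.1 j).2.1) j *
        ENNReal.ofReal (M.q k (a.1 j).1 (a.2 i).1) ≠ ⊤ := fun j => (ENNReal.mul_lt_top
        ((proportional_le_one _ _).trans_lt ENNReal.one_lt_top) ENNReal.ofReal_lt_top).ne
    have h2 : ∀ j, (proportional (fun j => (a.1 j).2.1) j *
        ENNReal.ofReal (M.q k (a.1 j).1 (a.2 i).1)).toReal =
        (∑ j, (a.1 j).2.1)⁻¹ * ((a.1 j).2.1 * M.q k (a.1 j).1 (a.2 i).1) := fun j => by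
      rw [ENNReal.toReal_mul, toReal_proportional hw hs, ENNReal.toReal_ofReal
        (M.q_nonneg _ _ _)]
      ring
    rw [Finset.sum_eq_single m
      (fun j _ hj => Set.indicator_of_notMem (by simpa using hj) _) (by simp),
      Set.indicator_of_mem (Set.mem_singleton m), ENNReal.toReal_mul, ENNReal.toReal_inv,
      ENNReal.toReal_sum fun j _ => h1 j, h2 m]
    simp only [h2]
    rw [← Finset.mul_sum, mul_inv, inv_inv]
    field_simp

end Algo

/-! ### Hoeffding's inequality for empirical means -/

lemma pi_mean_deviation_le {α : Type*} [MeasurableSpace α] (ν : Measure α)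
    [IsProbabilityMeasure ν] {φ : α → ℝ} (hφ : Measurable φ) {C : ℝ} (hC : 0 < C)
    (hb : ∀ᵐ x ∂ν, |φ x| ≤ C) {N : ℕ} (hN : N ≠ 0) {ε : ℝ} (hε : 0 < ε) :
    Measure.pi (fun _ : Fin N => ν) {s | ε ≤ |(N : ℝ)⁻¹ * ∑ i, φ (s i) - ∫ x, φ x ∂ν|} ≤
      ENNReal.ofReal (2 * Real.exp (-(2 * C ^ 2)⁻¹ * N * ε ^ 2)) := by
  have hN' : (0 : ℝ) < N := by exact_mod_cast Nat.pos_of_ne_zero hN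
  -- one-sided bound, to be applied to `φ` and to `-φ`
  have one : ∀ ψ : α → ℝ, Measurable ψ → (∀ᵐ x ∂ν, |ψ x| ≤ C) →
      Measure.pi (fun _ : Fin N => ν) {s | (N : ℝ) * ε ≤ ∑ i, (ψ (s i) - ∫ x, ψ x ∂ν)} ≤
        ENNReal.ofReal (Real.exp (-(2 * C ^ 2)⁻¹ * N * ε ^ 2)) := by
    intro ψ hψ hψb
    have h1 : HasSubgaussianMGF (fun x => ψ x - ∫ x, ψ x ∂ν) ((‖C - (-C)‖₊ / 2) ^ 2) ν :=
      hasSubgaussianMGF_of_mem_Icc hψ.aemeasurable (hψb.mono fun x hx => abs_le.1 hx)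
    have h2 : ∀ i : Fin N, HasSubgaussianMGF (fun s : Fin N → α => ψ (s i) - ∫ x, ψ x ∂ν)
        ((‖C - (-C)‖₊ / 2) ^ 2) (Measure.pi fun _ : Fin N => ν) := fun i => by
      have hm := measurePreserving_eval (fun _ : Fin N => ν) i
      refine HasSubgaussianMGF.of_map (X := fun x => ψ x - ∫ x, ψ x ∂ν)
        hm.measurable.aemeasurable ?_
      rwa [hm.map_eq]
    have h3 := HasSubgaussianMGF.measure_sum_ge_le_of_iIndepFun
      (iIndepFun_pi (μ := fun _ : Fin N => ν) (X := fun _ x => ψ x - ∫ x, ψ x ∂ν)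
        fun _ => (hψ.sub_const _).aemeasurable) (s := Finset.univ) (fun i _ => h2 i)
      (mul_pos hN' hε).le
    rw [← ofReal_measureReal]
    refine ENNReal.ofReal_le_ofReal (h3.trans (le_of_eq ?_))
    have h4 : ((∑ _i : Fin N, (‖C - (-C)‖₊ / 2) ^ 2 : NNReal) : ℝ) = N * C ^ 2 := by
      have : ‖C + C‖ = 2 * C := by rw [Real.norm_eq_abs, abs_of_pos (by linarith)]; ring
      simp [this]
    rw [h4]
    congr 1
    field_simp
  have hsub : {s : Fin N → α | ε ≤ |(N : ℝ)⁻¹ * ∑ i, φ (s i) - ∫ x, φ x ∂ν|} ⊆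
      {s | (N : ℝ) * ε ≤ ∑ i, (φ (s i) - ∫ x, φ x ∂ν)} ∪
      {s | (N : ℝ) * ε ≤ ∑ i, (-φ (s i) - ∫ x, -φ x ∂ν)} := by
    intro s hs
    have e1 : ∑ i, (φ (s i) - ∫ x, φ x ∂ν) =
        N * ((N : ℝ)⁻¹ * ∑ i, φ (s i) - ∫ x, φ x ∂ν) := by
      rw [Finset.sum_sub_distrib]
      simp
      field_simp
    have e2 : ∑ i, (-φ (s i) - ∫ x, -φ x ∂ν) = -∑ i, (φ (s i) - ∫ x, φ x ∂ν) := by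
      rw [integral_neg, ← Finset.sum_neg_distrib]
      exact Finset.sum_congr rfl fun i _ => by ring
    rcases le_abs.1 (show ε ≤ |(N : ℝ)⁻¹ * ∑ i, φ (s i) - ∫ x, φ x ∂ν| from hs) with h | h
    · left
      change (N : ℝ) * ε ≤ _
      rw [e1]
      exact mul_le_mul_of_nonneg_left h hN'.le
    · right
      change (N : ℝ) * ε ≤ _
      rw [e2, e1, ← mul_neg]
      exact mul_le_mul_of_nonneg_left h hN'.le
  refine (measure_mono hsub).trans ((measure_union_le _ _).trans ?_)
  refine (add_le_add (one φ hφ hb)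
    (one (fun x => -φ x) hφ.neg (by simpa only [abs_neg] using hb))).trans (le_of_eq ?_)
  rw [← ENNReal.ofReal_add (Real.exp_pos _).le (Real.exp_pos _).le]
  congr 1
  ring

/-! ### The law of the new particles given the current ones -/

lemma piKernel_apply {α β ι : Type*} [MeasurableSpace α] [MeasurableSpace β] [Fintype ι]
    (κ : ι → Kernel α β) [∀ i, IsFiniteKernel (κ i)] (a : α) :
    piKernel κ a = Measure.pi fun i => κ i a := rfl

namespace Algo

variable {N Nt k : ℕ} {h : ℕ → EuclideanSpace ℝ (Fin d) → EuclideanSpace ℝ (Fin d) → ℝ}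

lemma statistic_apply (hh : Measurable (Function.uncurry (h k)))
    (B : Kernel (Swarm d N × Cloud d N) (Fin N)) [IsMarkovKernel B] (i : Fin N)
    (a : Swarm d N × Cloud d N) :
    statistic h N Nt k B i a = (Measure.pi fun _ : Fin Nt => B a).map fun J =>
      (Nt : ℝ)⁻¹ * ∑ l, ((a.1 (J l)).2.2 + h k (a.1 (J l)).1 (a.2 i).1) := by
  unfold statistic
  rw [Kernel.map_apply _ (measurable_statistic hh N Nt i), Kernel.prod_apply, Kernel.id_apply,
    piKernel_apply, Measure.dirac_prod,
    Measure.map_map (measurable_statistic hh N Nt i) measurable_prodMk_left]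
  rfl

lemma isMarkovKernel_statistic (hh : Measurable (Function.uncurry (h k)))
    (B : Kernel (Swarm d N × Cloud d N) (Fin N)) [IsMarkovKernel B] (i : Fin N) :
    IsMarkovKernel (statistic h N Nt k B i) :=
  ⟨fun a => by
    rw [statistic_apply hh]
    exact Measure.isProbabilityMeasure_map Measurable.of_discrete.aemeasurable⟩

/-- The statistic of a new particle has the mean of the backward sampling law: averaging over
`Ñ` draws does not change the expectation. -/
lemma integral_statistic (hh : Measurable (Function.uncurry (h k))) (hNt : 1 ≤ Nt)
    (B : Kernel (Swarm d N × Cloud d N) (Fin N)) [IsMarkovKernel B] (i : Fin N)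
    (a : Swarm d N × Cloud d N) :
    ∫ t, t ∂statistic h N Nt k B i a =
      ∑ m, (B a).real {m} * ((a.1 m).2.2 + h k (a.1 m).1 (a.2 i).1) := by
  rw [statistic_apply hh, integral_map Measurable.of_discrete.aemeasurable
    measurable_id'.aestronglyMeasurable, integral_const_mul,
    integral_finsetSum _ fun _ _ => Integrable.of_finite]
  simp only [integral_comp_eval (μ := fun _ : Fin Nt => B a)
    (f := fun m => (a.1 m).2.2 + h k (a.1 m).1 (a.2 i).1)
    Measurable.of_discrete.aestronglyMeasurable, integral_fintype Integrable.of_finite,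
    smul_eq_mul, Finset.sum_const, Finset.card_univ, Fintype.card_fin, nsmul_eq_mul]
  rw [inv_mul_cancel_left₀]
  exact_mod_cast (by omega : Nt ≠ 0)

lemma ae_statistic_le (hh : Measurable (Function.uncurry (h k))) (hNt : 1 ≤ Nt)
    (B : Kernel (Swarm d N × Cloud d N) (Fin N)) [IsMarkovKernel B] (i : Fin N)
    (a : Swarm d N × Cloud d N) {D C : ℝ} (hD : ∀ m, |(a.1 m).2.2| ≤ D)
    (hC : ∀ x y, |h k x y| ≤ C) : ∀ᵐ t ∂statistic h N Nt k B i a, |t| ≤ D + C := by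
  rw [statistic_apply hh, ae_map_iff Measurable.of_discrete.aemeasurable
    (measurableSet_le measurable_id'.abs measurable_const)]
  refine ae_of_all _ fun J => ?_
  have hNt' : (0 : ℝ) < Nt := by exact_mod_cast hNt
  have h1 : |∑ l, ((a.1 (J l)).2.2 + h k (a.1 (J l)).1 (a.2 i).1)| ≤ Nt * (D + C) := by
    refine (Finset.abs_sum_le_sum_abs _ _).trans ?_
    refine (Finset.sum_le_card_nsmul _ _ (D + C) fun l _ =>
      (abs_add_le _ _).trans (add_le_add (hD _) (hC _ _))).trans (le_of_eq ?_)
    rw [Finset.card_univ, Fintype.card_fin, nsmul_eq_mul]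
  rw [abs_mul, abs_of_pos (inv_pos.2 hNt'), inv_mul_le_iff₀ hNt']
  exact h1

variable (𝒜 : Algo M Z) [NeZero N]

/-- The law, given the particles at time `k`, of the triple (position, weight, statistic) of one
new particle. As the backward sampler sees only the particle at hand, the new particles at the
other indices may be replaced by copies of it. -/
def newParticle (h : ℕ → E → E → ℝ) (Nt k : ℕ)
    (B : Fin N → Kernel (Swarm d N × Cloud d N) (Fin N)) [∀ i, IsFiniteKernel (B i)]
    (s : Swarm d N) : Measure (E × ℝ × ℝ) :=
  (𝒜.offspring N k s ⊗ₘ (statistic h N Nt k (B 0) 0).comap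
    (fun y => (s, fun _ => y)) (by fun_prop)).map fun b => (b.1.1, b.1.2, b.2)

lemma measurable_assoc : Measurable fun b : (E × ℝ) × ℝ => (b.1.1, b.1.2, b.2) := by fun_prop

variable {B : Fin N → Kernel (Swarm d N × Cloud d N) (Fin N)} [∀ i, IsFiniteKernel (B i)]

lemma isProbabilityMeasure_newParticle (hh : Measurable (Function.uncurry (h k)))
    (hB : IsBackwardSampler M k B) (s : Swarm d N) :
    IsProbabilityMeasure (𝒜.newParticle h Nt k B s) := by
  have := hB.markov 0
  have := isMarkovKernel_statistic (Nt := Nt) hh (B 0) 0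
  unfold newParticle
  exact Measure.isProbabilityMeasure_map measurable_assoc.aemeasurable

/-- Given the particles at time `k`, the new triples are independent and identically
distributed. -/
lemma step_apply (hh : Measurable (Function.uncurry (h k)))
    (hB : IsBackwardSampler M k B) (s : Swarm d N) :
    𝒜.step h N Nt k B s = Measure.pi fun _ : Fin N => 𝒜.newParticle h Nt k B s := by
  have hMk := hB.markov
  have hst : ∀ i, IsMarkovKernel (statistic h N Nt k (B i) i) := fun i =>
    isMarkovKernel_statistic hh (B i) i
  have := 𝒜.isProbabilityMeasure_newParticle (Nt := Nt) hh hB s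
  have hcongr : ∀ i c, statistic h N Nt k (B i) i (s, c) =
      statistic h N Nt k (B 0) 0 (s, fun _ => c i) := fun i c => by
    rw [statistic_apply hh, statistic_apply hh, hB.congr i]
  have hmap : Measurable fun (b : Cloud d N × (Fin N → ℝ)) (i : Fin N) =>
      ((b.1 i).1, (b.1 i).2, b.2 i) := by fun_prop
  refine (Measure.pi_eq fun S hS => ?_).symm
  have hms : MeasurableSet ((fun (b : Cloud d N × (Fin N → ℝ)) (i : Fin N) =>
      ((b.1 i).1, (b.1 i).2, b.2 i)) ⁻¹' Set.univ.pi S) :=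
    hmap (MeasurableSet.univ_pi hS)
  have hSi : ∀ i, MeasurableSet ((fun b : (E × ℝ) × ℝ => (b.1.1, b.1.2, b.2)) ⁻¹' S i) :=
    fun i => measurable_assoc (hS i)
  unfold step
  rw [Kernel.map_apply' _ hmap _ (MeasurableSet.univ_pi hS), Kernel.compProd_apply hms]
  have h1 : ∀ c : Cloud d N, piKernel (fun i : Fin N => statistic h N Nt k (B i) i) (s, c)
      (Prod.mk c ⁻¹' ((fun (b : Cloud d N × (Fin N → ℝ)) (i : Fin N) =>
        ((b.1 i).1, (b.1 i).2, b.2 i)) ⁻¹' Set.univ.pi S)) =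
      ∏ i, ((statistic h N Nt k (B 0) 0).comap
        (fun y => (s, fun _ => y)) (by fun_prop) : Kernel (E × ℝ) ℝ) (c i)
        (Prod.mk (c i) ⁻¹' ((fun b : (E × ℝ) × ℝ => (b.1.1, b.1.2, b.2)) ⁻¹' S i)) := fun c => by
    have : (Prod.mk c ⁻¹' ((fun (b : Cloud d N × (Fin N → ℝ)) (i : Fin N) =>
        ((b.1 i).1, (b.1 i).2, b.2 i)) ⁻¹' Set.univ.pi S)) = Set.univ.pi fun i =>
        (Prod.mk (c i) ⁻¹' ((fun b : (E × ℝ) × ℝ => (b.1.1, b.1.2, b.2)) ⁻¹' S i)) := by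
      ext t; simp
    rw [this, piKernel_apply, Measure.pi_pi]
    refine Finset.prod_congr rfl fun i _ => ?_
    rw [hcongr i c, Kernel.comap_apply]
  simp only [h1]
  have hF : ∀ i, Measurable fun y => ((statistic h N Nt k (B 0) 0).comap
        (fun y => (s, fun _ => y)) (by fun_prop) : Kernel (E × ℝ) ℝ) y
        (Prod.mk y ⁻¹' ((fun b : (E × ℝ) × ℝ => (b.1.1, b.1.2, b.2)) ⁻¹' S i)) := fun i =>
    Kernel.measurable_kernel_prodMk_left (hSi i)
  have h2 := lintegral_prod_eq_prod_lintegral_of_indepFun Finset.univ _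
    (iIndepFun_pi (μ := fun _ : Fin N => 𝒜.offspring N k s) fun i => (hF i).aemeasurable)
    fun i => (hF i).comp (measurable_pi_apply i)
  refine h2.trans (Finset.prod_congr rfl fun i _ => ?_)
  unfold newParticle
  rw [Measure.map_apply measurable_assoc (hS i), Measure.compProd_apply (hSi i)]
  exact (measurePreserving_eval (fun _ : Fin N => 𝒜.offspring N k s) i).lintegral_comp (hF i)

end Algo

/-! ### Conditional mean of the new particles -/

/-- The weighted empirical mean `N⁻¹ ∑ᵢ ω̂^i (τ^i f(ξ^i) + f'(ξ^i))` of a particle system. -/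
def weightedMean {N : ℕ} (f f' : EuclideanSpace ℝ (Fin d) → ℝ) (s : Swarm d N) : ℝ :=
  (N : ℝ)⁻¹ * ∑ i, (s i).2.1 * ((s i).2.2 * f (s i).1 + f' (s i).1)

/-- The weights of the particle system lie in `[0, W]`, and its statistics in `[-D, D]`. -/
def IsControlled {N : ℕ} (W D : ℝ) (s : Swarm d N) : Prop :=
  ∀ i, 0 ≤ (s i).2.1 ∧ (s i).2.1 ≤ W ∧ |(s i).2.2| ≤ D

lemma abs_summand_le {f f' : E → ℝ} {F F' W D : ℝ} (hF : ∀ x, |f x| ≤ F)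
    (hF' : ∀ x, |f' x| ≤ F') (hD : 0 ≤ D) {b : E × ℝ × ℝ}
    (hb : (0 ≤ b.2.1 ∧ b.2.1 ≤ W) ∧ |b.2.2| ≤ D) :
    |b.2.1 * (b.2.2 * f b.1 + f' b.1)| ≤ W * (D * F + F') := by
  rw [abs_mul, abs_of_nonneg hb.1.1]
  refine mul_le_mul hb.1.2 ((abs_add_le _ _).trans (add_le_add ?_ (hF' _))) (abs_nonneg _)
    (hb.1.1.trans hb.1.2)
  rw [abs_mul]
  exact mul_le_mul hb.2 (hF _) (abs_nonneg _) hD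

namespace Algo

variable {N Nt k : ℕ} {h : ℕ → EuclideanSpace ℝ (Fin d) → EuclideanSpace ℝ (Fin d) → ℝ}
  (𝒜 : Algo M Z)

lemma weight_eq (k : ℕ) (x y : E) (z : Z) :
    𝒜.weight k x y z =
      𝒜.qhat k x y z * (M.g (k + 1) y / (𝒜.ϑ (k + 1) x * 𝒜.p (k + 1) x y)) := by
  rw [weight, mul_div_assoc]

lemma integral_weight (k : ℕ) (x y : E) :
    ∫ z, 𝒜.weight k x y z ∂𝒜.ζlaw k (x, y) =
      M.q k x y * (M.g (k + 1) y / (𝒜.ϑ (k + 1) x * 𝒜.p (k + 1) x y)) := by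
  simp only [weight_eq]
  rw [integral_mul_const, 𝒜.qhat_unbiased]

lemma selection_real_singleton (s : Swarm d N) (m : Fin N) :
    (𝒜.selection N k s).real {m} =
      (proportional (fun j => (s j).2.1 * 𝒜.ϑ (k + 1) (s j).1) m).toReal := by
  rw [measureReal_def, ← categorical_singleton]
  rfl

lemma proposal_apply (x : E) :
    𝒜.proposal k x = M.μ.withDensity fun y => ENNReal.ofReal (𝒜.p k x y) := by
  unfold proposal
  rw [Kernel.withDensity_apply _ (𝒜.p_meas k).ennreal_ofReal, Kernel.const_apply]

lemma bddMeas_weight_mul {W : ℝ} (hW : ∀ x y z, |𝒜.weight k x y z| ≤ W) {G : E → ℝ}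
    (hG : BddMeas G) :
    BddMeas fun a : (E × E) × Z => 𝒜.weight k a.1.1 a.1.2 a.2 * G a.1.2 := by
  refine BddMeas.mul ⟨𝒜.measurable_weight k, |W|, abs_nonneg W, fun a =>
    (hW _ _ _).trans (le_abs_self W)⟩ (hG.comp (measurable_snd.comp measurable_fst))

variable [NeZero N]

lemma ancestor_apply (s : Swarm d N) :
    𝒜.ancestor N k s = (𝒜.selection N k s).map fun j => (s j).1 := by
  unfold ancestor
  rw [Kernel.map_apply _ (measurable_ancestor N), Kernel.prod_apply, Kernel.id_apply,
    Measure.dirac_prod, Measure.map_map (measurable_ancestor N) measurable_prodMk_left]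
  rfl

/-- The importance weight corrects for the adjustment multiplier and the proposal, and the
estimator of the transition density is unbiased: only the multiplier of the selected ancestor is
left. -/
lemma integral_offspring (hg : ∀ k, BddMeas (M.g k)) {W : ℝ}
    (hW : ∀ x y z, |𝒜.weight k x y z| ≤ W) {G : E → ℝ} (hG : BddMeas G) (s : Swarm d N) :
    ∫ b, b.2 * G b.1 ∂𝒜.offspring N k s = ∑ j,
      (proportional (fun j => (s j).2.1 * 𝒜.ϑ (k + 1) (s j).1) j).toReal *
        ((𝒜.ϑ (k + 1) (s j).1)⁻¹ * M.forward k (fun _ y => G y) (s j).1) := by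
  have hwG := 𝒜.bddMeas_weight_mul hW hG
  have hfw := M.bddMeas_forward hg k (F := fun _ y => G y) (hG.comp measurable_snd)
  -- the mean weight of a particle proposed from a given ancestor
  have inner : ∀ x, ∫ y, ∫ z, 𝒜.weight k x y z * G y ∂𝒜.ζlaw k (x, y) ∂𝒜.proposal (k + 1) x =
      (𝒜.ϑ (k + 1) x)⁻¹ * M.forward k (fun _ y => G y) x := fun x => by
    simp only [integral_mul_const, integral_weight]
    rw [proposal_apply, integral_withDensity_eq_integral_toReal_smul
      (𝒜.p_meas (k + 1)).of_uncurry_left.ennreal_ofReal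
      (ae_of_all _ fun _ => ENNReal.ofReal_lt_top)]
    unfold Model.forward
    rw [← integral_const_mul]
    congr 1
    ext y
    have hp := 𝒜.p_pos (k + 1) x y
    have hϑ := 𝒜.ϑ_pos (k + 1) x
    rw [ENNReal.toReal_ofReal hp.le, smul_eq_mul]
    field_simp
  have hm : Measurable fun b : E × ℝ => b.2 * G b.1 :=
    measurable_snd.mul (hG.meas.comp measurable_fst)
  unfold offspring
  rw [Kernel.map_apply _ (measurable_fst.snd.prodMk (𝒜.measurable_weight k)),
    integral_map (measurable_fst.snd.prodMk (𝒜.measurable_weight k)).aemeasurable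
      hm.aestronglyMeasurable, integral_compProd (hwG.integrable _),
    integral_compProd (hwG.integrable _).integral_compProd]
  simp only [Kernel.comap_apply, inner]
  have hm' : Measurable fun x => (𝒜.ϑ (k + 1) x)⁻¹ * M.forward k (fun _ y => G y) x :=
    (𝒜.ϑ_meas (k + 1)).inv.mul hfw.meas
  rw [ancestor_apply, integral_map Measurable.of_discrete.aemeasurable hm'.aestronglyMeasurable,
    integral_fintype Integrable.of_finite]
  simp only [selection_real_singleton, smul_eq_mul]

lemma ae_offspring (hgpos : ∀ k x, 0 < M.g k x) {W : ℝ}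
    (hW : ∀ x y z, |𝒜.weight k x y z| ≤ W) (s : Swarm d N) :
    ∀ᵐ b ∂𝒜.offspring N k s, 0 ≤ b.2 ∧ b.2 ≤ W := by
  have hm : Measurable fun a : (E × E) × Z => (a.1.2, 𝒜.weight k a.1.1 a.1.2 a.2) :=
    measurable_fst.snd.prodMk (𝒜.measurable_weight k)
  have hS : MeasurableSet {b : E × ℝ | 0 ≤ b.2 ∧ b.2 ≤ W} :=
    (measurableSet_le measurable_const measurable_snd).inter
      (measurableSet_le measurable_snd measurable_const)
  unfold offspring
  rw [Kernel.map_apply _ hm, ae_map_iff hm.aemeasurable hS]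
  refine (Kernel.ae_compProd_iff (hm hS)).2 (ae_of_all _ fun b => ?_)
  rw [Kernel.comap_apply]
  filter_upwards [𝒜.qhat_pos k b.1 b.2] with z hz
  refine ⟨?_, (le_abs_self _).trans (hW _ _ _)⟩
  rw [weight_eq]
  exact mul_nonneg hz.le (div_nonneg (hgpos _ _).le
    (mul_pos (𝒜.ϑ_pos _ _) (𝒜.p_pos _ _ _)).le)

variable {B : Fin N → Kernel (Swarm d N × Cloud d N) (Fin N)} [∀ i, IsFiniteKernel (B i)]

lemma ae_newParticle (hgpos : ∀ k x, 0 < M.g k x) {W : ℝ}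
    (hW : ∀ x y z, |𝒜.weight k x y z| ≤ W) (hh : Measurable (Function.uncurry (h k)))
    (hNt : 1 ≤ Nt) (hB : IsBackwardSampler M k B) {D C : ℝ} (hC : ∀ x y, |h k x y| ≤ C)
    {s : Swarm d N} (hs : ∀ i, |(s i).2.2| ≤ D) :
    ∀ᵐ b ∂𝒜.newParticle h Nt k B s, (0 ≤ b.2.1 ∧ b.2.1 ≤ W) ∧ |b.2.2| ≤ D + C := by
  have := hB.markov 0
  have hS : MeasurableSet {b : E × ℝ × ℝ | (0 ≤ b.2.1 ∧ b.2.1 ≤ W) ∧ |b.2.2| ≤ D + C} :=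
    ((measurableSet_le measurable_const measurable_snd.fst).inter
      (measurableSet_le measurable_snd.fst measurable_const)).inter
      (measurableSet_le measurable_snd.snd.abs measurable_const)
  unfold newParticle
  rw [ae_map_iff measurable_assoc.aemeasurable hS]
  refine (Measure.ae_compProd_iff (measurable_assoc hS)).2 ?_
  filter_upwards [𝒜.ae_offspring hgpos hW s] with y hy
  rw [Kernel.comap_apply]
  filter_upwards [ae_statistic_le hh hNt (B 0) 0 (s, fun _ => y) hs hC] with t ht
  exact ⟨hy, ht⟩

/-- Given the particles at time `k`, the mean of the weighted statistic of a new particle is a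
ratio of two weighted means of the current particles. The backward probabilities `Λ_k^N` cancel
against the density of the new position. -/
lemma integral_newParticle (hg : ∀ k, BddMeas (M.g k)) (hgpos : ∀ k x, 0 < M.g k x) {W : ℝ}
    (hW : ∀ x y z, |𝒜.weight k x y z| ≤ W) (hh : BddMeas (Function.uncurry (h k)))
    (hNt : 1 ≤ Nt) (hB : IsBackwardSampler M k B) {D : ℝ}
    {s : Swarm d N} (hs : IsControlled W D s) (hpos : 0 < ∑ i, (s i).2.1)
    {f f' : E → ℝ} (hf : BddMeas f) (hf' : BddMeas f') :
    ∫ b, b.2.1 * (b.2.2 * f b.1 + f' b.1) ∂𝒜.newParticle h Nt k B s =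
      weightedMean (M.forward k fun _ y => f y) (M.forward k fun x y => h k x y * f y + f' y) s /
        weightedMean (fun _ => 0) (𝒜.ϑ (k + 1)) s := by
  have hMk := hB.markov 0
  have hP := 𝒜.isProbabilityMeasure_newParticle (Nt := Nt) hh.meas hB s
  have hst := isMarkovKernel_statistic (Nt := Nt) hh.meas (B 0) 0
  have hq := 𝒜.q_pos k
  obtain ⟨C, hC0, hC⟩ := hh.bdd
  obtain ⟨F, hF0, hF⟩ := hf.bdd
  obtain ⟨F', hF'0, hF'⟩ := hf'.bdd
  have hD0 : 0 ≤ D := (abs_nonneg _).trans (hs 0).2.2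
  have hφm : Measurable fun b : E × ℝ × ℝ => b.2.1 * (b.2.2 * f b.1 + f' b.1) := by
    have := hf.meas
    have := hf'.meas
    fun_prop
  have hint : Integrable (fun b : E × ℝ × ℝ => b.2.1 * (b.2.2 * f b.1 + f' b.1))
      (𝒜.newParticle h Nt k B s) := by
    refine Integrable.of_bound hφm.aestronglyMeasurable (W * ((D + C) * F + F')) ?_
    filter_upwards [𝒜.ae_newParticle hgpos hW hh.meas hNt hB (fun x y => hC (x, y))
      fun i => (hs i).2.2] with b hb
    exact abs_summand_le hF hF' (by positivity) hb
  -- the conditional mean of the statistic of a new particle at position `y`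
  set num : E → ℝ := fun y => ∑ m, (s m).2.1 * M.q k (s m).1 y * ((s m).2.2 + h k (s m).1 y)
    with hnum
  set den : E → ℝ := fun y => ∑ m, (s m).2.1 * M.q k (s m).1 y with hden
  have hdenpos : ∀ y, 0 < den y := fun y =>
    sum_weight_mul_pos (fun j => (hs j).1) hpos fun j => hq (s j).1 y
  have hqm : ∀ m, Measurable (M.q k (s m).1) := fun m => (M.q_meas k).of_uncurry_left
  have hhm : ∀ m, Measurable (h k (s m).1) := fun m => hh.meas.of_uncurry_left
  have hmean : BddMeas fun y => num y / den y := by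
    refine ⟨Measurable.div ?_ ?_, D + C, by positivity, fun y => ?_⟩
    · exact Finset.measurable_sum _ fun m _ =>
        ((hqm m).const_mul _).mul ((hhm m).const_add _)
    · exact Finset.measurable_sum _ fun m _ => (hqm m).const_mul _
    · rw [abs_div, abs_of_pos (hdenpos y), div_le_iff₀ (hdenpos y), hden, Finset.mul_sum]
      refine (Finset.abs_sum_le_sum_abs _ _).trans (Finset.sum_le_sum fun m _ => ?_)
      have h0 := mul_nonneg (hs m).1 (M.q_nonneg k (s m).1 y)
      rw [abs_mul, abs_of_nonneg h0, mul_comm]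
      exact mul_le_mul_of_nonneg_right
        ((abs_add_le _ _).trans (add_le_add (hs m).2.2 (hC (_, _)))) h0
  have hstat : ∀ y : E × ℝ, ∫ t, y.2 * (t * f y.1 + f' y.1)
      ∂statistic h N Nt k (B 0) 0 (s, fun _ => y) =
      y.2 * (num y.1 / den y.1 * f y.1 + f' y.1) := fun y => by
    have hti : Integrable (fun t : ℝ => t) (statistic h N Nt k (B 0) 0 (s, fun _ => y)) :=
      Integrable.of_bound measurable_id'.aestronglyMeasurable (D + C)
        (ae_statistic_le hh.meas hNt (B 0) 0 _ (fun i => (hs i).2.2) fun x y => hC (x, y))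
    rw [integral_const_mul, integral_add (hti.mul_const _) (integrable_const _),
      integral_mul_const, integral_statistic hh.meas hNt]
    congr 3
    · rw [hnum, Finset.sum_div]
      refine Finset.sum_congr rfl fun m _ => ?_
      rw [hB.mass 0 (s, fun _ => y) (fun j => (hs j).1) hpos m]
      ring
    · simp
  have hG : BddMeas fun y => num y / den y * f y + f' y := (hmean.mul hf).add hf'
  have h1 : ∫ b, b.2.1 * (b.2.2 * f b.1 + f' b.1) ∂𝒜.newParticle h Nt k B s =
      ∫ y, y.2 * (num y.1 / den y.1 * f y.1 + f' y.1) ∂𝒜.offspring N k s := by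
    unfold newParticle at hint ⊢
    rw [integral_map measurable_assoc.aemeasurable hφm.aestronglyMeasurable]
    refine (Measure.integral_compProd ((integrable_map_measure hφm.aestronglyMeasurable
      measurable_assoc.aemeasurable).1 hint)).trans ?_
    simp only [Function.comp_apply, Kernel.comap_apply, hstat]
  have hϑ0 := fun j => 𝒜.ϑ_pos (k + 1) (s j).1
  have hϑs := sum_weight_mul_pos (fun j => (hs j).1) hpos hϑ0
  rw [h1, 𝒜.integral_offspring hg hW hG]
  simp only [toReal_proportional (fun j => mul_nonneg (hs j).1 (hϑ0 j).le) hϑs]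
  unfold weightedMean
  simp only [mul_zero, zero_add]
  rw [mul_div_mul_left _ _ (inv_ne_zero (by exact_mod_cast NeZero.ne N)), Finset.sum_div]
  -- both sides are now integrals of the same function, divided by the same constant
  have h2 : ∀ j, (s j).2.1 * 𝒜.ϑ (k + 1) (s j).1 / (∑ j, (s j).2.1 * 𝒜.ϑ (k + 1) (s j).1) *
      ((𝒜.ϑ (k + 1) (s j).1)⁻¹ *
        M.forward k (fun _ y => num y / den y * f y + f' y) (s j).1) =
      (s j).2.1 * M.forward k (fun _ y => num y / den y * f y + f' y) (s j).1 /
        (∑ j, (s j).2.1 * 𝒜.ϑ (k + 1) (s j).1) := fun j => by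
    have := (hϑ0 j).ne'
    field_simp
  simp only [h2]
  rw [← Finset.sum_div, ← Finset.sum_div]
  congr 1
  have i1 := fun j => M.integrable_forward hg k
    (F := fun _ y => num y / den y * f y + f' y) (hG.comp measurable_snd) (s j).1
  have i2 := fun j => M.integrable_forward hg k (F := fun _ y => f y) (hf.comp measurable_snd)
    (s j).1
  have i3 := fun j => M.integrable_forward hg k (F := fun x y => h k x y * f y + f' y)
    ((hh.mul (hf.comp measurable_snd)).add (hf'.comp measurable_snd)) (s j).1
  have e1 : ∀ j, (s j).2.1 * M.forward k (fun _ y => num y / den y * f y + f' y) (s j).1 =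
      ∫ y, (s j).2.1 * (M.q k (s j).1 y * M.g (k + 1) y * (num y / den y * f y + f' y)) ∂M.μ :=
    fun j => (integral_const_mul _ _).symm
  have e2 : ∀ j, (s j).2.1 * ((s j).2.2 * M.forward k (fun _ y => f y) (s j).1 +
      M.forward k (fun x y => h k x y * f y + f' y) (s j).1) =
      ∫ y, (s j).2.1 * ((s j).2.2 * (M.q k (s j).1 y * M.g (k + 1) y * f y) +
        M.q k (s j).1 y * M.g (k + 1) y * (h k (s j).1 y * f y + f' y)) ∂M.μ := fun j => by
    rw [integral_const_mul, integral_add ((i2 j).const_mul _) (i3 j), integral_const_mul]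
    rfl
  rw [Finset.sum_congr rfl fun j _ => e1 j, Finset.sum_congr rfl fun j _ => e2 j,
    ← integral_finsetSum _ fun j _ => (i1 j).const_mul _]
  refine Eq.trans ?_ (integral_finsetSum _ fun j _ =>
    (((i2 j).const_mul _).add (i3 j)).const_mul _)
  congr 1
  ext y
  have e4 : num y / den y * den y = num y := div_mul_cancel₀ _ (hdenpos y).ne'
  calc ∑ j, (s j).2.1 * (M.q k (s j).1 y * M.g (k + 1) y * (num y / den y * f y + f' y))
      = den y * (M.g (k + 1) y * (num y / den y * f y + f' y)) := by
        rw [hden, Finset.sum_mul]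
        exact Finset.sum_congr rfl fun j _ => by ring
    _ = M.g (k + 1) y * (num y / den y * den y * f y + den y * f' y) := by ring
    _ = _ := by
        rw [e4, hnum, hden]
        simp only [Finset.sum_mul, Finset.mul_sum, ← Finset.sum_add_distrib]
        exact Finset.sum_congr rfl fun j _ => by ring

end Algo

/-! ### Uniform exponential concentration -/

/-- The random variables `X i`, defined under the laws `P i`, concentrate at `a` with Gaussian
tails at the scale `(size i)^{-1/2}`, with constants that do not depend on the index `i`. -/
def ExpConcentrates {ι : Type*} {Ω : ι → Type*} [∀ i, MeasurableSpace (Ω i)] (size : ι → ℕ)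
    (P : ∀ i, Measure (Ω i)) (X : ∀ i, Ω i → ℝ) (a : ℝ) : Prop :=
  ∃ b c : ℝ, 0 < b ∧ 0 < c ∧ ∀ i ε, 0 < ε →
    P i {ω | ε ≤ |X i ω - a|} ≤ ENNReal.ofReal (b * Real.exp (-c * size i * ε ^ 2))

lemma add_gaussian_tail_le {b₁ b₂ c₁ c₂ α β : ℝ} (hb₁ : 0 < b₁) (hb₂ : 0 < b₂) (N : ℕ) (ε : ℝ) :
    ENNReal.ofReal (b₁ * Real.exp (-c₁ * N * (α * ε) ^ 2)) +
      ENNReal.ofReal (b₂ * Real.exp (-c₂ * N * (β * ε) ^ 2)) ≤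
      ENNReal.ofReal ((b₁ + b₂) * Real.exp (-min (c₁ * α ^ 2) (c₂ * β ^ 2) * N * ε ^ 2)) := by
  have h : ∀ c γ : ℝ, min (c₁ * α ^ 2) (c₂ * β ^ 2) ≤ c * γ ^ 2 →
      Real.exp (-c * N * (γ * ε) ^ 2) ≤
        Real.exp (-min (c₁ * α ^ 2) (c₂ * β ^ 2) * N * ε ^ 2) := fun c γ hc => by
    refine Real.exp_le_exp.2 ?_
    have := mul_le_mul_of_nonneg_right hc (by positivity : (0 : ℝ) ≤ N * ε ^ 2)
    linarith
  rw [← ENNReal.ofReal_add (by positivity) (by positivity), add_mul]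
  exact ENNReal.ofReal_le_ofReal (add_le_add
    (mul_le_mul_of_nonneg_left (h c₁ α (min_le_left _ _)) hb₁.le)
    (mul_le_mul_of_nonneg_left (h c₂ β (min_le_right _ _)) hb₂.le))

namespace ExpConcentrates

variable {ι : Type*} {Ω Ω' : ι → Type*} [∀ i, MeasurableSpace (Ω i)]
  [∀ i, MeasurableSpace (Ω' i)] {size : ι → ℕ} {P : ∀ i, Measure (Ω i)}

/-- Concentration of a bounded ratio. The identity `R * Y = X` is all that is required of `R`,
which may take any bounded value where `Y` vanishes. -/
lemma ratio {X Y R : ∀ i, Ω i → ℝ} {A B K : ℝ} (hX : ExpConcentrates size P X A)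
    (hY : ExpConcentrates size P Y B) (hB : 0 < B)
    (hR : ∀ i, ∀ᵐ ω ∂P i, |R i ω| ≤ K ∧ R i ω * Y i ω = X i ω) :
    ExpConcentrates size P R (A / B) := by
  obtain ⟨b₁, c₁, hb₁, hc₁, h₁⟩ := hX
  obtain ⟨b₂, c₂, hb₂, hc₂, h₂⟩ := hY
  have hK : 0 < |K| + 1 := by positivity
  refine ⟨b₁ + b₂, min (c₁ * (B / 2) ^ 2) (c₂ * (B / (2 * (|K| + 1))) ^ 2), by positivity,
    by positivity, fun i ε hε => ?_⟩
  refine le_trans ?_ (add_gaussian_tail_le hb₁ hb₂ (size i) ε)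
  refine le_trans ?_ (add_le_add (h₁ i (B / 2 * ε) (by positivity))
    (h₂ i (B / (2 * (|K| + 1)) * ε) (by positivity)))
  refine (measure_mono_ae ?_).trans (measure_union_le _ _)
  filter_upwards [hR i] with ω hω (hωε : ε ≤ |R i ω - A / B|)
  change B / 2 * ε ≤ |X i ω - A| ∨ B / (2 * (|K| + 1)) * ε ≤ |Y i ω - B|
  by_contra! hcon
  have h3 : R i ω - A / B = (R i ω * (B - Y i ω) + (X i ω - A)) / B := by
    rw [← hω.2]
    field_simp
    ring
  have h4 : |R i ω * (B - Y i ω)| < B / 2 * ε := by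
    rw [abs_mul, abs_sub_comm]
    calc |R i ω| * |Y i ω - B| ≤ (|K| + 1) * |Y i ω - B| :=
          mul_le_mul_of_nonneg_right (by linarith [hω.1, le_abs_self K]) (abs_nonneg _)
      _ < (|K| + 1) * (B / (2 * (|K| + 1)) * ε) := mul_lt_mul_of_pos_left hcon.2 hK
      _ = B / 2 * ε := by field_simp
  rw [h3, abs_div, abs_of_pos hB, le_div_iff₀ hB] at hωε
  have h5 := abs_add_le (R i ω * (B - Y i ω)) (X i ω - A)
  linarith [hcon.1]

/-- If `e` concentrates under `P`, and given the past `X` concentrates around `e`, then `X`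
concentrates under the law obtained by drawing from the kernels `κ`. -/
lemma bind [∀ i, IsProbabilityMeasure (P i)] (κ : ∀ i, Kernel (Ω i) (Ω' i)) {e : ∀ i, Ω i → ℝ}
    {X : ∀ i, Ω' i → ℝ} (hXm : ∀ i, Measurable (X i)) {A b c : ℝ} (hb : 0 < b) (hc : 0 < c)
    (he : ExpConcentrates size P e A)
    (hκ : ∀ i, ∀ᵐ ω ∂P i, IsProbabilityMeasure (κ i ω) ∧ ∀ ε, 0 < ε →
      κ i ω {ω' | ε ≤ |X i ω' - e i ω|} ≤
        ENNReal.ofReal (b * Real.exp (-c * size i * ε ^ 2))) :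
    ExpConcentrates size (fun i => (P i).bind (κ i)) X A := by
  obtain ⟨b₁, c₁, hb₁, hc₁, h₁⟩ := he
  refine ⟨b + b₁, min (c * (1 / 2) ^ 2) (c₁ * (1 / 2) ^ 2), by positivity, by positivity,
    fun i ε hε => ?_⟩
  refine le_trans ?_ (add_gaussian_tail_le hb hb₁ (size i) ε)
  have hm : MeasurableSet {ω' | ε ≤ |X i ω' - A|} :=
    measurableSet_le measurable_const ((hXm i).sub_const A).abs
  rw [Measure.bind_apply hm (κ i).aemeasurable]
  have hle : ∀ᵐ ω ∂P i, κ i ω {ω' | ε ≤ |X i ω' - A|} ≤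
      ENNReal.ofReal (b * Real.exp (-c * size i * (1 / 2 * ε) ^ 2)) +
        Set.indicator {ω | 1 / 2 * ε ≤ |e i ω - A|} 1 ω := by
    filter_upwards [hκ i] with ω hω
    have := hω.1
    by_cases hωe : 1 / 2 * ε ≤ |e i ω - A|
    · rw [Set.indicator_of_mem (by exact hωe)]
      exact prob_le_one.trans le_add_self
    · refine le_trans (measure_mono ?_) ((hω.2 (1 / 2 * ε) (by positivity)).trans le_self_add)
      intro ω' (hω' : ε ≤ |X i ω' - A|)
      change 1 / 2 * ε ≤ |X i ω' - e i ω|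
      have := abs_sub_le (X i ω') (e i ω) A
      linarith
  refine (lintegral_mono_ae hle).trans ?_
  rw [lintegral_add_left measurable_const, lintegral_const, measure_univ, mul_one]
  exact add_le_add le_rfl ((lintegral_indicator_one_le _).trans (h₁ i _ (by positivity)))

end ExpConcentrates

/-! ### Propagation through the particle system -/

namespace Algo

/-- A number `N` of particles together with a way of drawing the backward indices during the
first `n` steps. The constants of the concentration inequalities are uniform over this type. -/
structure BackwardScheme (M : Model d) (n : ℕ) where
  N : ℕ
  neZero : NeZero N
  sampler : ℕ → Fin N → Kernel (Swarm d N × Cloud d N) (Fin N)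
  finite : ∀ k i, IsFiniteKernel (sampler k i)
  isBackwardSampler : ∀ k < n, IsBackwardSampler M k (sampler k)

attribute [instance] BackwardScheme.neZero BackwardScheme.finite

variable {n Nt : ℕ} {h : ℕ → EuclideanSpace ℝ (Fin d) → EuclideanSpace ℝ (Fin d) → ℝ}
  (𝒜 : Algo M Z)

lemma measurable_weightedMean {N : ℕ} {f f' : E → ℝ} (hf : Measurable f) (hf' : Measurable f') :
    Measurable (weightedMean (N := N) f f') := by
  unfold weightedMean
  fun_prop

/-- The law of one initial particle, with its weight and statistic. -/
def initialParticle : Measure (E × ℝ × ℝ) :=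
  (M.μ.withDensity fun x => ENNReal.ofReal (𝒜.η₀ x)).map fun x => (x, 𝒜.weightInit x, (0 : ℝ))

lemma measurable_initialParticle : Measurable fun x => (x, 𝒜.weightInit x, (0 : ℝ)) := by
  have h1 := M.χ_meas
  have h2 := M.g_meas 0
  have h3 := 𝒜.η₀_meas
  unfold weightInit
  fun_prop

instance : IsProbabilityMeasure 𝒜.initialParticle := by
  have : IsProbabilityMeasure (M.μ.withDensity fun x => ENNReal.ofReal (𝒜.η₀ x)) :=
    ⟨by rw [withDensity_apply _ MeasurableSet.univ, Measure.restrict_univ, 𝒜.η₀_density]⟩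
  exact Measure.isProbabilityMeasure_map 𝒜.measurable_initialParticle.aemeasurable

lemma initial_eq (N : ℕ) : 𝒜.initial N = Measure.pi fun _ : Fin N => 𝒜.initialParticle := rfl

lemma ae_initialParticle {W : ℝ} (hW : ∀ x, |𝒜.weightInit x| ≤ W) :
    ∀ᵐ b ∂𝒜.initialParticle, (0 ≤ b.2.1 ∧ b.2.1 ≤ W) ∧ |b.2.2| ≤ 0 := by
  have hS : MeasurableSet {b : E × ℝ × ℝ | (0 ≤ b.2.1 ∧ b.2.1 ≤ W) ∧ |b.2.2| ≤ 0} :=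
    ((measurableSet_le measurable_const measurable_snd.fst).inter
      (measurableSet_le measurable_snd.fst measurable_const)).inter
      (measurableSet_le measurable_snd.snd.abs measurable_const)
  unfold initialParticle
  rw [ae_map_iff 𝒜.measurable_initialParticle.aemeasurable hS]
  exact ae_of_all _ fun x => ⟨⟨div_nonneg (mul_nonneg (M.χ_nonneg x) (M.g_nonneg 0 x))
    (𝒜.η₀_nonneg x), (le_abs_self _).trans (hW x)⟩, by simp⟩

lemma integral_initialParticle {f f' : E → ℝ} (hf : Measurable f) (hf' : Measurable f') :
    ∫ b, b.2.1 * (b.2.2 * f b.1 + f' b.1) ∂𝒜.initialParticle =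
      ∫ x, M.χ x * M.g 0 x * f' x ∂M.μ := by
  have hφ : Measurable fun b : E × ℝ × ℝ => b.2.1 * (b.2.2 * f b.1 + f' b.1) := by fun_prop
  unfold initialParticle
  rw [integral_map 𝒜.measurable_initialParticle.aemeasurable hφ.aestronglyMeasurable,
    integral_withDensity_eq_integral_toReal_smul 𝒜.η₀_meas.ennreal_ofReal
      (ae_of_all _ fun _ => ENNReal.ofReal_lt_top)]
  congr 1
  ext x
  rw [ENNReal.toReal_ofReal (𝒜.η₀_nonneg x), smul_eq_mul, zero_mul, zero_add, weightInit,
    ← mul_assoc]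
  congr 1
  -- the support of `χ` is contained in that of the proposal density
  by_cases h0 : 𝒜.η₀ x = 0
  · have : M.χ x = 0 := by_contra fun hne => 𝒜.η₀_ne_zero x hne h0
    simp [h0, this]
  · field_simp

lemma ae_pi_isControlled {N : ℕ} {ν : Measure (E × ℝ × ℝ)} [IsProbabilityMeasure ν] {W D : ℝ}
    (hν : ∀ᵐ b ∂ν, (0 ≤ b.2.1 ∧ b.2.1 ≤ W) ∧ |b.2.2| ≤ D) :
    ∀ᵐ s ∂Measure.pi fun _ : Fin N => ν, IsControlled W D s := by
  refine ae_all_iff.2 fun i => ?_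
  filter_upwards [(Measure.quasiMeasurePreserving_eval (fun _ : Fin N => ν) i).ae hν] with s hs
  exact ⟨hs.1.1, hs.1.2, hs.2⟩

lemma measurableSet_isControlled {N : ℕ} (W D : ℝ) :
    MeasurableSet {s : Swarm d N | IsControlled W D s} := by
  have : {s : Swarm d N | IsControlled W D s} =
      ⋂ i, {s | 0 ≤ (s i).2.1 ∧ (s i).2.1 ≤ W ∧ |(s i).2.2| ≤ D} := by
    ext s
    simp [IsControlled]
  rw [this]
  refine MeasurableSet.iInter fun i => ?_
  have h1 : Measurable fun s : Swarm d N => (s i).2.1 := by fun_prop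
  have h2 : Measurable fun s : Swarm d N => |(s i).2.2| := by fun_prop
  exact (measurableSet_le measurable_const h1).inter
    ((measurableSet_le h1 measurable_const).inter (measurableSet_le h2 measurable_const))

/-- The algorithm is well defined up to time `n`, and keeps its weights and statistics in a
compact range that does not depend on the number of particles. -/
lemma exists_isControlled (hgpos : ∀ k x, 0 < M.g k x) {W : ℝ}
    (hW0 : ∀ x, |𝒜.weightInit x| ≤ W) (hW : ∀ k x y z, |𝒜.weight k x y z| ≤ W)
    (hh : ∀ j < n, BddMeas (Function.uncurry (h j))) (hNt : 1 ≤ Nt) {k : ℕ} (hk : k ≤ n) :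
    ∃ D, 0 ≤ D ∧ ∀ S : BackwardScheme M n,
      IsProbabilityMeasure (𝒜.law h S.N Nt S.sampler k) ∧
        ∀ᵐ s ∂𝒜.law h S.N Nt S.sampler k, IsControlled W D s := by
  induction k with
  | zero =>
    refine ⟨0, le_rfl, fun S => ?_⟩
    change IsProbabilityMeasure (𝒜.initial S.N) ∧ ∀ᵐ s ∂𝒜.initial S.N, _
    rw [initial_eq]
    exact ⟨inferInstance, ae_pi_isControlled (𝒜.ae_initialParticle hW0)⟩
  | succ k ih =>
    obtain ⟨D, hD0, hD⟩ := ih (by omega)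
    have hhk := hh k (by omega)
    obtain ⟨C, hC0, hC⟩ := hhk.bdd
    refine ⟨D + C, by positivity, fun S => ?_⟩
    have hB := S.isBackwardSampler k (by omega)
    obtain ⟨hP, hae⟩ := hD S
    have hstep : ∀ s, IsProbabilityMeasure (𝒜.step h S.N Nt k (S.sampler k) s) := fun s => by
      have := 𝒜.isProbabilityMeasure_newParticle (Nt := Nt) hhk.meas hB s
      rw [𝒜.step_apply hhk.meas hB s]
      infer_instance
    have hstepM : IsMarkovKernel (𝒜.step h S.N Nt k (S.sampler k)) := ⟨hstep⟩
    change IsProbabilityMeasure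
      ((𝒜.law h S.N Nt S.sampler k).bind (𝒜.step h S.N Nt k (S.sampler k))) ∧
      ∀ᵐ s ∂(𝒜.law h S.N Nt S.sampler k).bind (𝒜.step h S.N Nt k (S.sampler k)), _
    refine ⟨inferInstance, ?_⟩
    have hm := (measurableSet_isControlled (d := d) (N := S.N) W (D + C)).compl
    rw [ae_iff]
    refine (Measure.bind_apply hm (Kernel.aemeasurable _)).trans ?_
    refine (lintegral_congr_ae (g := fun _ => 0) ?_).trans lintegral_zero
    filter_upwards [hae] with s hs
    have := 𝒜.isProbabilityMeasure_newParticle (Nt := Nt) hhk.meas hB s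
    rw [𝒜.step_apply hhk.meas hB s]
    exact ae_iff.1 (ae_pi_isControlled (𝒜.ae_newParticle hgpos (hW k) hhk.meas hNt hB
      (fun x y => hC (x, y)) fun i => (hs i).2.2))

/-- The constant by which the limit of the weighted means of the particles at time `k` differs
from the unnormalized path integral: `c_0 = 1` and `c_{k+1} = Γ_k(0, ϑ_{k+1})`. -/
def normalizer (h : ℕ → E → E → ℝ) : ℕ → ℝ
  | 0 => 1
  | k + 1 => M.pathIntegral h k (fun _ => 0) (𝒜.ϑ (k + 1))

lemma normalizer_pos (hg : ∀ k, BddMeas (M.g k)) (hgpos : ∀ k x, 0 < M.g k x)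
    (hϑ : ∀ k, BddMeas (𝒜.ϑ (k + 1))) (h : ℕ → E → E → ℝ) (k : ℕ) : 0 < 𝒜.normalizer h k := by
  cases k with
  | zero => exact one_pos
  | succ k => exact Model.pathIntegral_pos hg hgpos 𝒜.q_pos h k (hϑ k) (𝒜.ϑ_pos (k + 1))

lemma weightedMean_of_sum_eq_zero {N : ℕ} {s : Swarm d N} (hs : ∀ i, 0 ≤ (s i).2.1)
    (h0 : ∑ i, (s i).2.1 = 0) (f f' : E → ℝ) : weightedMean f f' s = 0 := by
  have h1 := (Finset.sum_eq_zero_iff_of_nonneg fun i _ => hs i).1 h0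
  unfold weightedMean
  rw [Finset.sum_eq_zero fun i hi => by rw [h1 i hi, zero_mul], mul_zero]

/-- Concentration of all weighted means, by induction on the time. The test functions have to be
arbitrary, because each step replaces them by their images under the forward operator. -/
lemma expConcentrates_weightedMean (hg : ∀ k, BddMeas (M.g k)) (hgpos : ∀ k x, 0 < M.g k x)
    (hϑ : ∀ k, BddMeas (𝒜.ϑ (k + 1))) {W : ℝ} (hW0 : ∀ x, |𝒜.weightInit x| ≤ W)
    (hW : ∀ k x y z, |𝒜.weight k x y z| ≤ W)
    (hh : ∀ j < n, BddMeas (Function.uncurry (h j))) (hNt : 1 ≤ Nt) {k : ℕ} (hk : k ≤ n)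
    {f f' : E → ℝ} (hf : BddMeas f) (hf' : BddMeas f') :
    ExpConcentrates (fun S : BackwardScheme M n => S.N)
      (fun S => 𝒜.law h S.N Nt S.sampler k) (fun _ => weightedMean f f')
      (M.pathIntegral h k f f' / 𝒜.normalizer h k) := by
  have hWnn : 0 ≤ W := (abs_nonneg _).trans (hW0 0)
  induction k generalizing f f' with
  | zero =>
    obtain ⟨F, hF0, hF⟩ := hf.bdd
    obtain ⟨F', hF'0, hF'⟩ := hf'.bdd
    have hK : 0 < W * (0 * F + F') + 1 := by positivity
    refine ⟨2, (2 * (W * (0 * F + F') + 1) ^ 2)⁻¹, by positivity, by positivity,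
      fun S ε hε => ?_⟩
    have hφ : Measurable fun b : E × ℝ × ℝ => b.2.1 * (b.2.2 * f b.1 + f' b.1) := by
      have := hf.meas
      have := hf'.meas
      fun_prop
    have := pi_mean_deviation_le 𝒜.initialParticle hφ hK
      ((𝒜.ae_initialParticle hW0).mono fun b hb =>
        (abs_summand_le hF hF' le_rfl hb).trans (by linarith)) (NeZero.ne S.N) hε
    rw [𝒜.integral_initialParticle hf.meas hf'.meas] at this
    rw [Model.pathIntegral_zero, show 𝒜.normalizer h 0 = 1 from rfl, div_one]
    exact this
  | succ k ih =>
    have hkn : k < n := by omega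
    have hhk := hh k hkn
    obtain ⟨C, hC0, hC⟩ := hhk.bdd
    obtain ⟨F, hF0, hF⟩ := hf.bdd
    obtain ⟨F', hF'0, hF'⟩ := hf'.bdd
    obtain ⟨D, hD0, hD⟩ := 𝒜.exists_isControlled hgpos hW0 hW hh hNt hkn.le
    have hφ : Measurable fun b : E × ℝ × ℝ => b.2.1 * (b.2.2 * f b.1 + f' b.1) := by
      have := hf.meas
      have := hf'.meas
      fun_prop
    have hK : 0 < W * ((D + C) * F + F') + 1 := by positivity
    have hbd : ∀ (S : BackwardScheme M n) (s : Swarm d S.N), IsControlled W D s →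
        ∀ᵐ b ∂𝒜.newParticle h Nt k (S.sampler k) s,
          |b.2.1 * (b.2.2 * f b.1 + f' b.1)| ≤ W * ((D + C) * F + F') + 1 := fun S s hs =>
      (𝒜.ae_newParticle hgpos (hW k) hhk.meas hNt (S.isBackwardSampler k hkn)
        (fun x y => hC (x, y)) fun i => (hs i).2.2).mono fun b hb =>
          (abs_summand_le hF hF' (by positivity) hb).trans (by linarith)
    -- the conditional mean of the weighted mean at time `k + 1` is a bounded ratio
    have hmean : ExpConcentrates (fun S : BackwardScheme M n => S.N)
        (fun S => 𝒜.law h S.N Nt S.sampler k)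
        (fun S s => ∫ b, b.2.1 * (b.2.2 * f b.1 + f' b.1)
          ∂𝒜.newParticle h Nt k (S.sampler k) s)
        (M.pathIntegral h (k + 1) f f' / 𝒜.normalizer h (k + 1)) := by
      have hnum := ih hkn.le (Model.bddMeas_forward hg k (F := fun _ y => f y)
        (hf.comp measurable_snd)) (Model.bddMeas_forward hg k
        (F := fun x y => h k x y * f y + f' y)
        ((hhk.mul (hf.comp measurable_snd)).add (hf'.comp measurable_snd)))
      have hden := ih hkn.le (BddMeas.const 0) (hϑ k)
      have hc := 𝒜.normalizer_pos hg hgpos hϑ h k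
      have hp := Model.pathIntegral_pos hg hgpos 𝒜.q_pos h k (hϑ k) (𝒜.ϑ_pos (k + 1))
      have := hnum.ratio hden (div_pos hp hc) (K := W * ((D + C) * F + F') + 1)
        (R := fun S s => ∫ b, b.2.1 * (b.2.2 * f b.1 + f' b.1)
          ∂𝒜.newParticle h Nt k (S.sampler k) s) fun S => by
        filter_upwards [(hD S).2] with s hs
        have hB := S.isBackwardSampler k hkn
        have := 𝒜.isProbabilityMeasure_newParticle (Nt := Nt) hhk.meas hB s
        have hle := norm_integral_le_of_norm_le_const
          (f := fun b : E × ℝ × ℝ => b.2.1 * (b.2.2 * f b.1 + f' b.1)) (hbd S s hs)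
        rw [probReal_univ, mul_one] at hle
        refine ⟨hle, ?_⟩
        rcases (Finset.sum_nonneg fun i _ => (hs i).1).eq_or_lt' with h0 | hpos
        · simp only [weightedMean_of_sum_eq_zero (fun i => (hs i).1) h0, mul_zero]
        · rw [𝒜.integral_newParticle hg hgpos (hW k) hhk hNt hB hs hpos hf hf']
          refine div_mul_cancel₀ _ ?_
          have h1 := sum_weight_mul_pos (fun i => (hs i).1) hpos
            fun i => 𝒜.ϑ_pos (k + 1) (s i).1
          unfold weightedMean
          simp only [mul_zero, zero_add]
          exact mul_ne_zero (inv_ne_zero (by exact_mod_cast NeZero.ne S.N)) h1.ne'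
      rwa [div_div_div_cancel_right₀ hc.ne',
        ← Model.pathIntegral_succ hg (fun j hj => hh j (by omega)) hf hf'] at this
    have (S : BackwardScheme M n) :
        IsProbabilityMeasure (𝒜.law h S.N Nt S.sampler k) := (hD S).1
    have hcond : ∀ S : BackwardScheme M n, ∀ᵐ s ∂𝒜.law h S.N Nt S.sampler k,
        IsProbabilityMeasure (𝒜.step h S.N Nt k (S.sampler k) s) ∧ ∀ ε, 0 < ε →
          𝒜.step h S.N Nt k (S.sampler k) s {s' | ε ≤ |weightedMean f f' s' -
            ∫ b, b.2.1 * (b.2.2 * f b.1 + f' b.1) ∂𝒜.newParticle h Nt k (S.sampler k) s|} ≤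
          ENNReal.ofReal (2 * Real.exp
            (-(2 * (W * ((D + C) * F + F') + 1) ^ 2)⁻¹ * S.N * ε ^ 2)) := fun S => by
      filter_upwards [(hD S).2] with s hs
      have hB := S.isBackwardSampler k hkn
      have := 𝒜.isProbabilityMeasure_newParticle (Nt := Nt) hhk.meas hB s
      rw [𝒜.step_apply hhk.meas hB s]
      exact ⟨inferInstance, fun ε hε =>
        pi_mean_deviation_le _ hφ hK (hbd S s hs) (NeZero.ne S.N) hε⟩
    exact ExpConcentrates.bind (P := fun S : BackwardScheme M n => 𝒜.law h S.N Nt S.sampler k)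
      (fun S => 𝒜.step h S.N Nt k (S.sampler k)) (X := fun _ => weightedMean f f')
      (fun _ => measurable_weightedMean hf.meas hf'.meas) two_pos
      (c := (2 * (W * ((D + C) * F + F') + 1) ^ 2)⁻¹) (by positivity) hmean hcond

lemma estimator_mul {N : ℕ} {s : Swarm d N} (hs : ∀ i, 0 ≤ (s i).2.1) :
    estimator s * weightedMean (fun _ => 0) (fun _ => 1) s =
      weightedMean (fun _ => 1) (fun _ => 0) s := by
  rcases (Finset.sum_nonneg fun i _ => hs i).eq_or_lt' with h0 | hpos
  · simp only [weightedMean_of_sum_eq_zero hs h0, mul_zero]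
  · unfold estimator weightedMean
    simp only [mul_one, mul_zero, zero_add, add_zero]
    rw [mul_left_comm, div_mul_cancel₀ _ hpos.ne']

lemma abs_estimator_le {N : ℕ} {W D : ℝ} (hD : 0 ≤ D) {s : Swarm d N}
    (hs : IsControlled W D s) : |estimator s| ≤ D := by
  have h0 : 0 ≤ ∑ i, (s i).2.1 := Finset.sum_nonneg fun i _ => (hs i).1
  unfold estimator
  rw [abs_div, abs_of_nonneg h0]
  refine div_le_of_le_mul₀ h0 hD ((Finset.abs_sum_le_sum_abs _ _).trans ?_)
  rw [Finset.mul_sum]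
  refine Finset.sum_le_sum fun i _ => ?_
  rw [abs_mul, abs_of_nonneg (hs i).1, mul_comm]
  exact mul_le_mul_of_nonneg_right (hs i).2.2 (hs i).1

/-- Concentration of the particle smoother, uniformly over the backward sampling schemes. -/
lemma expConcentrates_estimator (hg : ∀ k, BddMeas (M.g k)) (hgpos : ∀ k x, 0 < M.g k x)
    (hϑ : ∀ k, BddMeas (𝒜.ϑ (k + 1))) {W : ℝ} (hW0 : ∀ x, |𝒜.weightInit x| ≤ W)
    (hW : ∀ k x y z, |𝒜.weight k x y z| ≤ W)
    (hh : ∀ j < n, BddMeas (Function.uncurry (h j))) (hNt : 1 ≤ Nt) {k : ℕ} (hk : k ≤ n) :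
    ExpConcentrates (fun S : BackwardScheme M n => S.N)
      (fun S => 𝒜.law h S.N Nt S.sampler k) (fun _ => estimator)
      (∫ x, M.T k (additive h k) x ∂M.filter k) := by
  have hc := 𝒜.normalizer_pos hg hgpos hϑ h k
  have hp := Model.pathIntegral_pos hg hgpos 𝒜.q_pos h k (BddMeas.const 1) fun _ => one_pos
  obtain ⟨D, hD0, hD⟩ := 𝒜.exists_isControlled hgpos hW0 hW hh hNt hk
  have conc := fun a b : ℝ => 𝒜.expConcentrates_weightedMean hg hgpos hϑ hW0 hW hh hNt hk
    (BddMeas.const a) (BddMeas.const b)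
  have := (conc 1 0).ratio (conc 0 1) (div_pos hp hc) (K := D) (R := fun _ => estimator)
    fun S => by
      filter_upwards [(hD S).2] with s hs
      exact ⟨abs_estimator_le hD0 hs, estimator_mul fun i => (hs i).1⟩
  rwa [div_div_div_cancel_right₀ hc.ne', ← Model.integral_T_additive hg hgpos 𝒜.q_pos
    fun j hj => hh j (by omega)] at this

end Algo

end GRandPaRIS

end

open GRandPaRIS GRandPaRIS.Algo in
theorem proposition1 {d : ℕ} (M : Model d) {Z : Type*} [MeasurableSpace Z] (𝒜 : Algo M Z)
    (h : ℕ → EuclideanSpace ℝ (Fin d) → EuclideanSpace ℝ (Fin d) → ℝ) (n : ℕ)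
    (hH1 : BoundedModel M) (hH2 : 𝒜.BoundedAlgo)
    (hmeas : ∀ j < n, Measurable (Function.uncurry (h j)))
    (hosc : ∀ j < n, osc (Function.uncurry (h j)) < ⊤) :
    ∀ k ≤ n, ∀ Nt : ℕ, 1 ≤ Nt → ∃ b c : ℝ, 0 < b ∧ 0 < c ∧
      ∀ (N : ℕ) [NeZero N] (ε : ℝ), 0 < ε →
        𝒜.law h N Nt (backwardIndex M N) k
            {s | ε ≤ |estimator s - ∫ x, M.T k (additive h k) x ∂M.filter k|}
          ≤ ENNReal.ofReal (b * Real.exp (-c * N * ε ^ 2)) ∧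
        ∀ (σ : ℕ → Swarm d N × Cloud d N → ℝ) (hσ : ∀ j, Measurable (σ j)),
          (∀ j < n, 𝒜.Admissible j (σ j)) →
          𝒜.law h N Nt (fun j => 𝒜.acceptRejectIndex N j (σ j) (hσ j)) k
              {s | ε ≤ |estimator s - ∫ x, M.T k (additive h k) x ∂M.filter k|}
            ≤ ENNReal.ofReal (b * Real.exp (-c * N * ε ^ 2)) := by
  intro k hk Nt hNt
  obtain ⟨hgpos, hgb⟩ := hH1
  obtain ⟨hϑb, -, hw0, hw⟩ := hH2
  have hg : ∀ k, BddMeas (M.g k) := fun k => BddMeas.of_supNorm (M.g_meas k)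
    ((le_iSup (fun k => supNorm (M.g k)) k).trans_lt hgb)
  have hϑ : ∀ k, BddMeas (𝒜.ϑ (k + 1)) := fun k => BddMeas.of_supNorm (𝒜.ϑ_meas _)
    ((le_iSup (fun k => supNorm (𝒜.ϑ (k + 1))) k).trans_lt hϑb)
  have hh : ∀ j < n, BddMeas (Function.uncurry (h j)) := fun j hj =>
    BddMeas.of_osc 0 (hmeas j hj) (hosc j hj)
  obtain ⟨W, hW0, hW⟩ : ∃ W, (∀ x, |𝒜.weightInit x| ≤ W) ∧
      ∀ k x y z, |𝒜.weight k x y z| ≤ W := by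
    refine ⟨_, fun x => (abs_le_of_supNorm_le le_rfl hw0 x).trans (le_max_left _ _),
      fun k x y z => (abs_le_of_supNorm_le (le_iSup (fun k => supNorm fun a :
        EuclideanSpace ℝ (Fin d) × EuclideanSpace ℝ (Fin d) × Z =>
          𝒜.weight k a.1 a.2.1 a.2.2) k) hw (x, y, z)).trans (le_max_right _ _)⟩
  obtain ⟨b, c, hb, hc, H⟩ :=
    𝒜.expConcentrates_estimator hg hgpos hϑ hW0 hW hh hNt hk
  exact ⟨b, c, hb, hc, fun N _ ε hε =>
    ⟨H ⟨N, inferInstance, backwardIndex M N, fun _ _ => inferInstance,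
      fun j _ => isBackwardSampler_backwardIndex 𝒜.q_pos N j⟩ ε hε,
    fun σ hσ hadm => H ⟨N, inferInstance, fun j => 𝒜.acceptRejectIndex N j (σ j) (hσ j),
      fun _ _ => inferInstance,
      fun j hj => 𝒜.isBackwardSampler_acceptRejectIndex (hσ j) (hadm j hj)⟩ ε hε⟩⟩
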